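/- A workflow $W=(S,U,\leqslant,A,C)$ consists of a finite poset $(S,\leqslant)$ of $k$ steps, a finite set $U$ of $n$ users, an authorization relation $A\subseteq S\times U$ such that every step $s$ has some user $u$ with $(s,u)\in A$, and a family $C$ of $c$ constraints; each constraint $\gamma$ is given by a finite code and stands for a set of plans $\pi:S\to U$, those that satisfy $\gamma$. A plan is valid if $(s,\pi(s))\in A$ for all $s\in S$ and it satisfies every $\gamma\in C$. For a plan $\pi$ let $[s]_\pi=\{s'\in S:\pi(s')=\pi(s)\}$ and $S/\pi=\{[s]_\pi : s\in S\}$. A set $F\subseteq S$ is $\gamma$-ineligible if every plan $\pi$ with $F\in S/\pi$ violates $\gamma$, and $\gamma$-eligible otherwise. The constraint $\gamma$ is regular if every plan $\pi$ for which all classes $[s]_\pi$, $s\in S$, are $\gamma$-eligible satisfies $\gamma$. Running times are measured on a random access machine with logarithmic cost that has random access to the input. Let $\mathcal W$ be a class of workflows such that (i) every constraint of every $W\in\mathcal W$ is regular, and (ii) there is an algorithm that, given $W\in\mathcal W$, a constraint $\gamma$ of $W$ and a set $F\subseteq S$, determines whether $F$ is $\gamma$-eligible in time polynomial in $k$ (it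 suffices: polynomial in $k$, $\log n$ and $\log c$). Then the workflow satisfiability problem for $\mathcal W$ can be solved in time $\widetilde O(2^k(c+n^2))$: there are an algorithm and constants $K,d$ such that for every $W\in\mathcal W$ the algorithm outputs a valid plan, or correctly reports that there is none, in time at most $K\,(T\log^d T+1)$, where $T=2^k(c+n^2)$ and $\log$ is the binary logarithm (rounded down, and taken to be $0$ for $T=0$). -/

import Mathlib

/-! ## Random access machine with logarithmic cost

Structured programs over a random access memory.  There are registers, named in the program text,
a read-only input and a work memory, the latter two addressed indirectly: cell `i` of array `a`.
Registers and cells hold natural numbers of any size; every operation is charged one unit plus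
the bit lengths of all the numbers (addresses included) that it handles. -/

namespace RAM

/-- Arithmetic operations: addition, truncated subtraction, multiplication, floor division. -/
inductive Op where
  | add
  | sub
  | mul
  | div

def Op.eval : Op → ℕ → ℕ → ℕ
  | .add, a, b => a + b
  | .sub, a, b => a - b
  | .mul, a, b => a * b
  | .div, a, b => a / b

/-- Programs.  All arguments of type `ℕ` are names of registers, except the value `v`. -/
inductive Prog where
  | skip : Prog
  /-- `x := v` -/
  | const (x v : ℕ) : Prog
  /-- `x := y o z` -/
  | op (o : Op) (x y z : ℕ) : Prog
  /-- `x := input[y][z]` -/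
  | input (x y z : ℕ) : Prog
  /-- `x := memory[y][z]` -/
  | load (x y z : ℕ) : Prog
  /-- `memory[y][z] := x` -/
  | store (y z x : ℕ) : Prog
  | seq (p q : Prog) : Prog
  /-- if `x ≠ 0` then `p` else `q` -/
  | ite (x : ℕ) (p q : Prog) : Prog
  /-- while `x ≠ 0` do `p` -/
  | loop (x : ℕ) (p : Prog) : Prog

structure State where
  reg : ℕ → ℕ
  mem : ℕ → ℕ → ℕ

def State.setReg (σ : State) (x v : ℕ) : State :=
  { σ with reg := Function.update σ.reg x v }

def State.setMem (σ : State) (a i v : ℕ) : State :=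
  { σ with mem := Function.update σ.mem a (Function.update (σ.mem a) i v) }

/-- The state in which a program starts: the arguments in the first registers, zero elsewhere. -/
def start (args : List ℕ) : State where
  reg i := args.getD i 0
  mem _ _ := 0

/-- `Runs inp p σ t σ'`: on the input `inp`, the program `p` started in the state `σ` halts in the
state `σ'`, at the total cost `t`. -/
inductive Runs (inp : ℕ → ℕ → ℕ) : Prog → State → ℕ → State → Prop where
  | skip (σ : State) : Runs inp .skip σ 1 σ
  | const (σ : State) (x v : ℕ) : Runs inp (.const x v) σ (1 + v.size) (σ.setReg x v)
  | op (σ : State) (o : Op) (x y z : ℕ) :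
      Runs inp (.op o x y z) σ
        (1 + (σ.reg y).size + (σ.reg z).size + (o.eval (σ.reg y) (σ.reg z)).size)
        (σ.setReg x (o.eval (σ.reg y) (σ.reg z)))
  | input (σ : State) (x y z : ℕ) :
      Runs inp (.input x y z) σ
        (1 + (σ.reg y).size + (σ.reg z).size + (inp (σ.reg y) (σ.reg z)).size)
        (σ.setReg x (inp (σ.reg y) (σ.reg z)))
  | load (σ : State) (x y z : ℕ) :
      Runs inp (.load x y z) σ
        (1 + (σ.reg y).size + (σ.reg z).size + (σ.mem (σ.reg y) (σ.reg z)).size)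
        (σ.setReg x (σ.mem (σ.reg y) (σ.reg z)))
  | store (σ : State) (y z x : ℕ) :
      Runs inp (.store y z x) σ
        (1 + (σ.reg y).size + (σ.reg z).size + (σ.reg x).size)
        (σ.setMem (σ.reg y) (σ.reg z) (σ.reg x))
  | seq {p q : Prog} {σ σ' σ'' : State} {t t' : ℕ} :
      Runs inp p σ t σ' → Runs inp q σ' t' σ'' → Runs inp (.seq p q) σ (t + t') σ''
  | ite_true {x : ℕ} {p q : Prog} {σ σ' : State} {t : ℕ} :
      σ.reg x ≠ 0 → Runs inp p σ t σ' →
        Runs inp (.ite x p q) σ (1 + (σ.reg x).size + t) σ'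
  | ite_false {x : ℕ} {p q : Prog} {σ σ' : State} {t : ℕ} :
      σ.reg x = 0 → Runs inp q σ t σ' → Runs inp (.ite x p q) σ (1 + t) σ'
  | loop_true {x : ℕ} {p : Prog} {σ σ' σ'' : State} {t t' : ℕ} :
      σ.reg x ≠ 0 → Runs inp p σ t σ' → Runs inp (.loop x p) σ' t' σ'' →
        Runs inp (.loop x p) σ (1 + (σ.reg x).size + t + t') σ''
  | loop_false {x : ℕ} {p : Prog} {σ : State} :
      σ.reg x = 0 → Runs inp (.loop x p) σ 1 σ

end RAM

/-! ## Workflows -/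

namespace WSP

/-- A plan assigns a user to every step; there are `k` steps and `n` users. -/
abbrev Plan (k n : ℕ) := Fin k → Fin n

/-- The equivalence class of the step `s` under the plan `π`: the steps that the user of `s`
performs. -/
def Plan.block {k n : ℕ} (π : Plan k n) (s : Fin k) : Finset (Fin k) :=
  Finset.univ.filter fun s' => π s' = π s

/-- A constraint: its syntax, which is what an algorithm gets to see (a finite sequence of
numbers in any encoding), and its meaning, the plans that satisfy it. -/
structure Constraint (k n : ℕ) where
  code : List ℕ
  sat : Plan k n → Prop

namespace Constraint

variable {k n : ℕ}

/-- `F` is ineligible if every plan that has `F` as one of its equivalence classes violates the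
constraint. -/
def Ineligible (γ : Constraint k n) (F : Finset (Fin k)) : Prop :=
  ∀ π : Plan k n, (∃ s, F = π.block s) → ¬ γ.sat π

def Eligible (γ : Constraint k n) (F : Finset (Fin k)) : Prop :=
  ¬ γ.Ineligible F

/-- Every plan all of whose equivalence classes are eligible satisfies the constraint. -/
def Regular (γ : Constraint k n) : Prop :=
  ∀ π : Plan k n, (∀ s, γ.Eligible (π.block s)) → γ.sat π

end Constraint

/-- A constrained workflow authorization schema with `k` steps, `n` users and `c` constraints;
for every step there is an authorized user. -/
structure Workflow where
  k : ℕ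
  n : ℕ
  c : ℕ
  order : PartialOrder (Fin k)
  auth : Fin k → Fin n → Prop
  exists_auth : ∀ s, ∃ u, auth s u
  con : Fin c → Constraint k n

namespace Workflow

/-- A plan is valid if it is authorized and satisfies all constraints. -/
def Valid (W : Workflow) (π : Plan W.k W.n) : Prop :=
  (∀ s, W.auth s (π s)) ∧ ∀ j, (W.con j).sat π

open Classical in
/-- The workflow as the input of a program.  Array 0 holds `k`, `n`, `c`; arrays 1 and 2 hold
the 0/1 matrices of the order and of the authorization relation, row by row; array `j + 3` holds
the code of the `j`-th constraint, preceded by its length. -/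
noncomputable def input (W : Workflow) : ℕ → ℕ → ℕ
  | 0, i => [W.k, W.n, W.c].getD i 0
  | 1, i => if ∃ s s' : Fin W.k, i = s * W.k + s' ∧ W.order.le s s' then 1 else 0
  | 2, i => if ∃ (s : Fin W.k) (u : Fin W.n), i = s * W.n + u ∧ W.auth s u then 1 else 0
  | j + 3, i =>
      if h : j < W.c then ((W.con ⟨j, h⟩).code.length :: (W.con ⟨j, h⟩).code).getD i 0 else 0

/-- The quantity `2 ^ k * (c + n ^ 2)`. -/
def bound (W : Workflow) : ℕ := 2 ^ W.k * (W.c + W.n ^ 2)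

end Workflow

/-- A set of steps as a number: bit `s` is set if and only if `s ∈ F`. -/
def mask {k : ℕ} (F : Finset (Fin k)) : ℕ := ∑ s ∈ F, 2 ^ (s : ℕ)

open Classical in
/-- On the input `W` and the arguments `j` (index of a constraint) and `F` (a set of steps), the
program `E` decides, at cost at most `B`, whether `F` is eligible for the `j`-th constraint. -/
def DecidesEligibility (E : RAM.Prog) (W : Workflow) (B : ℕ) : Prop :=
  ∀ (j : Fin W.c) (F : Finset (Fin W.k)), ∃ (t : ℕ) (σ : RAM.State),
    RAM.Runs W.input E (RAM.start [(j : ℕ), mask F]) t σ ∧ t ≤ B ∧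
      σ.reg 0 = if (W.con j).Eligible F then 1 else 0

/-- On the input `W`, the program `P` solves the workflow satisfiability problem at cost at most
`B`: it answers 1 and leaves a valid plan in array 0 of the memory, or it answers 0 and there is
no valid plan. -/
def Solves (P : RAM.Prog) (W : Workflow) (B : ℕ) : Prop :=
  ∃ (t : ℕ) (σ : RAM.State),
    RAM.Runs W.input P (RAM.start []) t σ ∧ t ≤ B ∧
      ((σ.reg 0 = 1 ∧ ∃ π, W.Valid π ∧ ∀ s : Fin W.k, σ.mem 0 s = (π s : ℕ)) ∨
        (σ.reg 0 = 0 ∧ ¬ ∃ π, W.Valid π))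

end WSP

/-! A plan is described by the disjoint, possibly empty sets of steps that it gives to the users 0,
…, n-1. A nonempty set of this kind is an equivalence class, and all classes of a valid plan are
eligible for every constraint. Regularity supplies the converse, so a plan is valid exactly when
each user's set is authorized and either empty or eligible for all constraints (`Valid.coverable`,
`valid_of_fits`). The question becomes whether the set of all steps is `Coverable` by n users.
Coverability by i + 1 users is the subset convolution of `Fits i` with coverability by i users.

The admissible sets are found by 2^k·c eligibility tests. A subset convolution takes 2^k·poly(k)
operations. With B = 2^(k+1), each set F in a family gets the weight B^|F|. In the covering product,
a pair of sets with union V contributes B^|V| if it is disjoint, and a multiple of B^(|V|+1)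
otherwise. Fewer than B pairs are disjoint, so the value modulo B^(|V|+1) is nonzero exactly when a
disjoint pair exists (`unionProd_weighted_mod`). The zeta transform turns the covering product into
a pointwise product (`partialZeta_unionProd`), and it is computed and inverted in place by k sweeps
over the table. All tables are kept, and a plan is read off from the last user to the first.

On the machine, `WP` counts operations on numbers of at most L bits, each of which costs at most 3L
+ 1. The given eligibility test expects zero memory at the start of each call. Each call therefore
has its arrays moved into a residue class of array numbers that nothing else has used
(`wp_relocate`, `wp_callProg`). The total cost is 2^k(c + n + 1) times a power of `bits`, and
`bits_pow_le` compares this with T times a power of log T. -/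

namespace RAM

-- Total correctness with a cost budget

infixr:60 " ;; " => Prog.seq

@[simp] theorem State.reg_setReg (σ : State) (x v r : ℕ) :
    (σ.setReg x v).reg r = if r = x then v else σ.reg r := by
  simp [State.setReg, Function.update_apply]

@[simp] theorem State.mem_setReg (σ : State) (x v : ℕ) : (σ.setReg x v).mem = σ.mem := rfl

@[simp] theorem State.reg_setMem (σ : State) (a i v : ℕ) : (σ.setMem a i v).reg = σ.reg := rfl

theorem State.mem_setMem (σ : State) (a i v b j : ℕ) :
    (σ.setMem a i v).mem b j = if b = a ∧ j = i then v else σ.mem b j := by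
  simp only [State.setMem, Function.update_apply]
  by_cases h : b = a
  · subst h; simp [Function.update_apply]
  · simp [h]

theorem State.mem_setMem_of_ne (σ : State) {a i v b : ℕ} (h : b ≠ a) :
    (σ.setMem a i v).mem b = σ.mem b := by
  simp [State.setMem, h]

/-- All numbers in the registers and in the memory have at most `L` bits. -/
structure Bdd (L : ℕ) (σ : State) : Prop where
  reg : ∀ r, σ.reg r < 2 ^ L
  mem : ∀ a i, σ.mem a i < 2 ^ L

theorem Bdd.setReg {L : ℕ} {σ : State} (h : Bdd L σ) {x v : ℕ} (hv : v < 2 ^ L) :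
    Bdd L (σ.setReg x v) := by
  refine ⟨fun r => ?_, h.mem⟩
  rw [State.reg_setReg]
  split_ifs
  exacts [hv, h.reg r]

theorem Bdd.setMem {L : ℕ} {σ : State} (h : Bdd L σ) {a i v : ℕ} (hv : v < 2 ^ L) :
    Bdd L (σ.setMem a i v) := by
  refine ⟨h.reg, fun b j => ?_⟩
  rw [State.mem_setMem]
  split_ifs
  exacts [hv, h.mem b j]

/-- Weakest precondition with a budget of `N` operations on numbers of at most `L` bits: started in
`σ`, provided that `σ` is bounded, the program halts within this budget in a bounded state that
satisfies `Q`. -/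
def WP (inp : ℕ → ℕ → ℕ) (L : ℕ) (p : Prog) (σ : State) (N : ℕ) (Q : State → Prop) : Prop :=
  Bdd L σ → ∃ t σ', Runs inp p σ t σ' ∧ t ≤ N * (3 * L + 1) ∧ Bdd L σ' ∧ Q σ'

section

variable {inp : ℕ → ℕ → ℕ} {L : ℕ} {p q : Prog} {σ : State} {N N' : ℕ} {Q Q' : State → Prop}

theorem WP.mono (h : WP inp L p σ N Q) (hN : N ≤ N') : WP inp L p σ N' Q := by
  intro hb
  obtain ⟨t, σ', h1, h2, h3⟩ := h hb
  exact ⟨t, σ', h1, h2.trans (Nat.mul_le_mul_right _ hN), h3⟩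

theorem WP.imp (h : WP inp L p σ N Q) (hQ : ∀ σ', Q σ' → Q' σ') : WP inp L p σ N Q' := by
  intro hb
  obtain ⟨t, σ', h1, h2, h3, h4⟩ := h hb
  exact ⟨t, σ', h1, h2, h3, hQ _ h4⟩

theorem WP.of_bdd (h : Bdd L σ → WP inp L p σ N Q) : WP inp L p σ N Q := fun hb => h hb hb

theorem wp_seq (h : WP inp L p σ N fun σ' => WP inp L q σ' N' Q) :
    WP inp L (p ;; q) σ (N + N') Q := by
  intro hb
  obtain ⟨t, σ', h1, h2, h3, h4⟩ := h hb
  obtain ⟨t', σ'', k1, k2, k3⟩ := h4 h3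
  exact ⟨_, _, .seq h1 k1, by rw [add_mul]; exact add_le_add h2 k2, k3⟩

theorem wp_skip (h : Q σ) : WP inp L .skip σ 1 Q :=
  fun hb => ⟨_, _, .skip σ, by omega, hb, h⟩

theorem wp_const {x v : ℕ} (hv : v < 2 ^ L) (h : Q (σ.setReg x v)) :
    WP inp L (.const x v) σ 1 Q := by
  intro hb
  refine ⟨_, _, .const σ x v, ?_, hb.setReg hv, h⟩
  have := Nat.size_le.2 hv
  omega

theorem wp_op {o : Op} {x y z : ℕ} (v : ℕ) (hv : o.eval (σ.reg y) (σ.reg z) = v)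
    (hL : v < 2 ^ L) (h : Q (σ.setReg x v)) : WP inp L (.op o x y z) σ 1 Q := by
  intro hb
  subst hv
  refine ⟨_, _, .op σ o x y z, ?_, hb.setReg hL, h⟩
  have := Nat.size_le.2 hL
  have := Nat.size_le.2 (hb.reg y)
  have := Nat.size_le.2 (hb.reg z)
  omega

/-- Truncated subtraction does not exceed its first operand, so the size of the result needs no
separate hypothesis. -/
theorem wp_sub {x y z : ℕ} (v : ℕ) (hv : σ.reg y - σ.reg z = v) (h : Q (σ.setReg x v)) :
    WP inp L (.op .sub x y z) σ 1 Q :=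
  WP.of_bdd fun hb =>
    wp_op v hv (lt_of_le_of_lt (by rw [← hv]; exact Nat.sub_le _ _) (hb.reg y)) h

theorem wp_div {x y z : ℕ} (v : ℕ) (hv : σ.reg y / σ.reg z = v) (h : Q (σ.setReg x v)) :
    WP inp L (.op .div x y z) σ 1 Q :=
  WP.of_bdd fun hb =>
    wp_op v hv (lt_of_le_of_lt (by rw [← hv]; exact Nat.div_le_self _ _) (hb.reg y)) h

theorem wp_input {x y z : ℕ} (v : ℕ) (hv : inp (σ.reg y) (σ.reg z) = v)
    (hL : v < 2 ^ L) (h : Q (σ.setReg x v)) : WP inp L (.input x y z) σ 1 Q := by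
  intro hb
  subst hv
  refine ⟨_, _, .input σ x y z, ?_, hb.setReg hL, h⟩
  have := Nat.size_le.2 hL
  have := Nat.size_le.2 (hb.reg y)
  have := Nat.size_le.2 (hb.reg z)
  omega

theorem wp_load {x y z : ℕ} (v : ℕ) (hv : σ.mem (σ.reg y) (σ.reg z) = v)
    (h : Q (σ.setReg x v)) : WP inp L (.load x y z) σ 1 Q := by
  intro hb
  have hL := hb.mem (σ.reg y) (σ.reg z)
  subst hv
  refine ⟨_, _, .load σ x y z, ?_, hb.setReg hL, h⟩
  have := Nat.size_le.2 hL
  have := Nat.size_le.2 (hb.reg y)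
  have := Nat.size_le.2 (hb.reg z)
  omega

theorem wp_store {x y z : ℕ} (a i v : ℕ) (ha : σ.reg y = a) (hi : σ.reg z = i)
    (hv : σ.reg x = v) (h : Q (σ.setMem a i v)) : WP inp L (.store y z x) σ 1 Q := by
  intro hb
  subst ha hi hv
  refine ⟨_, _, .store σ y z x, ?_, hb.setMem (hb.reg x), h⟩
  have := Nat.size_le.2 (hb.reg x)
  have := Nat.size_le.2 (hb.reg y)
  have := Nat.size_le.2 (hb.reg z)
  omega

theorem wp_ite {x : ℕ} (h1 : σ.reg x ≠ 0 → WP inp L p σ N Q)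
    (h2 : σ.reg x = 0 → WP inp L q σ N' Q) : WP inp L (.ite x p q) σ (1 + N + N') Q := by
  intro hb
  by_cases h : σ.reg x = 0
  · obtain ⟨t, σ', r1, r2, r3⟩ := h2 h hb
    refine ⟨_, σ', .ite_false h r1, ?_, r3⟩
    rw [add_mul, add_mul]
    have := Nat.zero_le (N * (3 * L + 1))
    omega
  · obtain ⟨t, σ', r1, r2, r3⟩ := h1 h hb
    refine ⟨_, σ', .ite_true h r1, ?_, r3⟩
    rw [add_mul, add_mul]
    have := Nat.zero_le (N' * (3 * L + 1))
    have := Nat.size_le.2 (hb.reg x)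
    omega

theorem wp_loop_false {x : ℕ} (hx : σ.reg x = 0) (h : Q σ) : WP inp L (.loop x p) σ 1 Q :=
  fun hb => ⟨_, _, .loop_false hx, by omega, hb, h⟩

theorem wp_loop_true {x : ℕ} (hx : σ.reg x ≠ 0)
    (h : WP inp L p σ N fun σ' => WP inp L (.loop x p) σ' N' Q) :
    WP inp L (.loop x p) σ (1 + N + N') Q := by
  intro hb
  obtain ⟨t, σ', h1, h2, h3, h4⟩ := h hb
  obtain ⟨t', σ'', k1, k2, k3⟩ := h4 h3
  refine ⟨_, _, .loop_true hx h1 k1, ?_, k3⟩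
  have := Nat.size_le.2 (hb.reg x)
  rw [add_mul, add_mul]
  omega

end

/-! ### Counting loops -/

/-- `for i := 0, 1, …, lim - 1 do body`.  The body must not change the registers up to `i`, and
register 1 has to hold the number 1; register `i + 1` is used for the loop condition. -/
def forLoop (i lim : ℕ) (body : Prog) : Prog :=
  .const i 0 ;; .op .sub (i + 1) lim i ;;
    .loop (i + 1) (body ;; .op .add i i 1 ;; .op .sub (i + 1) lim i)

/-- Nested loops of the solver have counters that increase inwards among 10, 20, 30, 40, so the
frame condition on the registers up to `i` passes from inner to outer loops. A round costs three
operations besides the body: the test, the increment and the new condition. `stab` says that the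
invariant ignores the two registers of the loop control. -/
theorem wp_forLoop {inp : ℕ → ℕ → ℕ} {L : ℕ} {σ₀ : State} {Q : State → Prop} {i lim : ℕ}
    {body : Prog} (Inv : ℕ → State → Prop) (l N : ℕ)
    (hl : σ₀.reg lim = l) (h1 : σ₀.reg 1 = 1) (hlim : lim < i) (hi : 1 < i)
    (stab : ∀ m σ v w, Inv m σ → Inv m ((σ.setReg i v).setReg (i + 1) w))
    (init : Inv 0 σ₀)
    (step : ∀ m σ, m < l → σ.reg i = m → (∀ r < i, σ.reg r = σ₀.reg r) → Inv m σ →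
      WP inp L body σ N fun σ' => (∀ r ≤ i, σ'.reg r = σ.reg r) ∧ Inv (m + 1) σ')
    (post : ∀ σ', (∀ r < i, σ'.reg r = σ₀.reg r) → Inv l σ' → Q σ') :
    WP inp L (forLoop i lim body) σ₀ (l * (N + 3) + 3) Q := by
  apply WP.of_bdd
  intro hb
  have hlL : l < 2 ^ L := hl ▸ hb.reg lim
  -- The induction is on the number `d` of remaining rounds, which is what the condition register
  -- holds.
  have key : ∀ d m σ, m + d = l → σ.reg i = m → σ.reg (i + 1) = d →
      (∀ r < i, σ.reg r = σ₀.reg r) → Inv m σ →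
      WP inp L (.loop (i + 1) (body ;; .op .add i i 1 ;; .op .sub (i + 1) lim i)) σ
        (d * (N + 3) + 1) Q := by
    intro d
    induction d with
    | zero =>
      intro m σ hm hi' hd hfr hInv
      refine (wp_loop_false hd (post σ hfr ?_)).mono (by omega)
      simpa [← hm] using hInv
    | succ d ih =>
      intro m σ hm hi' hd hfr hInv
      refine (wp_loop_true (N := N + 2) (N' := d * (N + 3) + 1) (by omega) (wp_seq ?_)).mono
        (by rw [add_mul]; omega)
      refine (step m σ (by omega) hi' hfr hInv).imp ?_
      rintro σ' ⟨hfr', hInv'⟩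
      have e1 : σ'.reg i = m := by rw [hfr' i le_rfl, hi']
      have e2 : σ'.reg 1 = 1 := by rw [hfr' 1 hi.le, hfr 1 hi, h1]
      have e3 : σ'.reg lim = l := by rw [hfr' lim hlim.le, hfr lim hlim, hl]
      refine wp_seq (N := 1) (N' := 1) (wp_op (m + 1) (by simp [Op.eval, e1, e2]) (by omega) ?_)
      refine wp_sub d (by simp [hlim.ne, e3]; omega) ?_
      refine ih (m + 1) _ (by omega) (by simp) (by simp) ?_ (stab _ _ _ _ hInv')
      intro r hr
      have : r ≠ i := hr.ne
      have : r ≠ i + 1 := by omega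
      simp [*, hfr' r hr.le]
  refine (wp_seq (wp_const (by positivity) (wp_seq (wp_sub l (by simp [hlim.ne, hl])
    (key l 0 _ (by omega) (by simp) (by simp) ?_ (stab _ _ _ _ init)))))).mono (by omega)
  intro r hr
  have : r ≠ i := hr.ne
  have : r ≠ i + 1 := by omega
  simp [*]

/-! ### Relocation of a program, and subroutine calls -/

/-- All registers named in the program are less than this number. -/
def Prog.regBound : Prog → ℕ
  | .skip => 0
  | .const x _ => x + 1
  | .op _ x y z => max (x + 1) (max (y + 1) (z + 1))
  | .input x y z => max (x + 1) (max (y + 1) (z + 1))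
  | .load x y z => max (x + 1) (max (y + 1) (z + 1))
  | .store y z x => max (x + 1) (max (y + 1) (z + 1))
  | .seq p q => max p.regBound q.regBound
  | .ite x p q => max (x + 1) (max p.regBound q.regBound)
  | .loop x p => max (x + 1) p.regBound

/-- The program with its registers shifted by `b` and with its array `y` moved to the array
`y * M + q`, where `M` and `q` are the contents of the registers `b - 3` and `b - 2`; the register
`b - 1` is used for the computation of addresses. -/
def Prog.relocate (b : ℕ) : Prog → Prog
  | .skip => .skip
  | .const x v => .const (b + x) v
  | .op o x y z => .op o (b + x) (b + y) (b + z)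
  | .input x y z => .input (b + x) (b + y) (b + z)
  | .load x y z =>
      .op .mul (b - 1) (b + y) (b - 3) ;; .op .add (b - 1) (b - 1) (b - 2) ;;
        .load (b + x) (b - 1) (b + z)
  | .store y z x =>
      .op .mul (b - 1) (b + y) (b - 3) ;; .op .add (b - 1) (b - 1) (b - 2) ;;
        .store (b - 1) (b + z) (b + x)
  | .seq p q => .seq (p.relocate b) (q.relocate b)
  | .ite x p q => .ite (b + x) (p.relocate b) (q.relocate b)
  | .loop x p => .loop (b + x) (p.relocate b)

/-- The state `τ` of a relocated program represents the state `σ` of the original one. -/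
structure Represents (b M q : ℕ) (σ τ : State) : Prop where
  reg : ∀ r, τ.reg (b + r) = σ.reg r
  mem : ∀ y, τ.mem (y * M + q) = σ.mem y
  modulus : τ.reg (b - 3) = M
  residue : τ.reg (b - 2) = q

/-- What a relocated program with registers below `R` leaves unchanged. -/
structure RelocFrame (b M q R : ℕ) (τ τ' : State) : Prop where
  low : ∀ r < b - 1, τ'.reg r = τ.reg r
  high : ∀ r, b + R ≤ r → τ'.reg r = τ.reg r
  mem : ∀ a, a % M ≠ q → τ'.mem a = τ.mem a

theorem RelocFrame.refl {b M q R : ℕ} (τ : State) : RelocFrame b M q R τ τ :=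
  ⟨fun _ _ => rfl, fun _ _ => rfl, fun _ _ => rfl⟩

theorem RelocFrame.trans {b M q R : ℕ} {τ τ' τ'' : State} (h : RelocFrame b M q R τ τ')
    (h' : RelocFrame b M q R τ' τ'') : RelocFrame b M q R τ τ'' :=
  ⟨fun r hr => (h'.low r hr).trans (h.low r hr), fun r hr => (h'.high r hr).trans (h.high r hr),
    fun a ha => (h'.mem a ha).trans (h.mem a ha)⟩

variable {b M q R : ℕ} {σ τ : State}

theorem Represents.setReg (h : Represents b M q σ τ) (hb : 3 ≤ b) (x v : ℕ) :
    Represents b M q (σ.setReg x v) (τ.setReg (b + x) v) := by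
  refine ⟨fun r => ?_, h.mem, ?_, ?_⟩
  · simp [h.reg]
  · rw [State.reg_setReg, if_neg (by omega), h.modulus]
  · rw [State.reg_setReg, if_neg (by omega), h.residue]

theorem Represents.setAddr (h : Represents b M q σ τ) (hb : 3 ≤ b) (v : ℕ) :
    Represents b M q σ (τ.setReg (b - 1) v) := by
  refine ⟨fun r => ?_, h.mem, ?_, ?_⟩
  · rw [State.reg_setReg, if_neg (by omega), h.reg]
  · rw [State.reg_setReg, if_neg (by omega), h.modulus]
  · rw [State.reg_setReg, if_neg (by omega), h.residue]

theorem Represents.setMem (h : Represents b M q σ τ) (hq : q < M) (y i v : ℕ) :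
    Represents b M q (σ.setMem y i v) (τ.setMem (y * M + q) i v) := by
  refine ⟨h.reg, fun y' => ?_, h.modulus, h.residue⟩
  by_cases hy : y' = y
  · subst hy
    simp [State.setMem, h.mem]
  · rw [State.mem_setMem_of_ne, State.mem_setMem_of_ne _ hy, h.mem]
    intro e
    have : M ≠ 0 := by omega
    simp_all

theorem RelocFrame.setReg (hb : 3 ≤ b) {x v : ℕ} (hx : x < R) :
    RelocFrame b M q R τ (τ.setReg (b + x) v) := by
  refine ⟨fun r hr => ?_, fun r hr => ?_, fun _ _ => rfl⟩
  · rw [State.reg_setReg, if_neg (by omega)]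
  · rw [State.reg_setReg, if_neg (by omega)]

theorem RelocFrame.setAddr (hb : 3 ≤ b) {v : ℕ} :
    RelocFrame b M q R τ (τ.setReg (b - 1) v) := by
  refine ⟨fun r hr => ?_, fun r hr => ?_, fun _ _ => rfl⟩
  · rw [State.reg_setReg, if_neg (by omega)]
  · rw [State.reg_setReg, if_neg (by omega)]

theorem RelocFrame.setMem (hq : q < M) {y i v : ℕ} :
    RelocFrame b M q R τ (τ.setMem (y * M + q) i v) := by
  refine ⟨fun _ _ => rfl, fun _ _ => rfl, fun a ha => State.mem_setMem_of_ne _ ?_⟩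
  rintro rfl
  apply ha
  rw [Nat.mul_add_mod_self_right, Nat.mod_eq_of_lt hq]

/-- The address computation of a relocated program. -/
theorem wp_address {inp : ℕ → ℕ → ℕ} {L B N : ℕ} {p : Prog} {Q : State → Prop} (hb : 3 ≤ b)
    (hq : q < M) (hL : 2 ^ B * M ≤ 2 ^ L) (h : Represents b M q σ τ) {y : ℕ}
    (hy : σ.reg y < 2 ^ B)
    (hp : ∀ τ', Represents b M q σ τ' → RelocFrame b M q R τ τ' → τ'.reg (b - 1) = σ.reg y * M + q →
      WP inp L p τ' N Q) :
    WP inp L (.op .mul (b - 1) (b + y) (b - 3) ;; .op .add (b - 1) (b - 1) (b - 2) ;; p) τ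
      (2 + N) Q := by
  have hlt : σ.reg y * M + q < 2 ^ L := by
    have : (σ.reg y + 1) * M ≤ 2 ^ B * M := Nat.mul_le_mul_right _ hy
    rw [add_mul, one_mul] at this
    omega
  refine (wp_seq (wp_op (σ.reg y * M) ?_ (by omega) (wp_seq (wp_op (σ.reg y * M + q) ?_ hlt
    (hp _ ((h.setAddr hb _).setAddr hb _) ((RelocFrame.setAddr hb).trans (.setAddr hb))
      (by simp)))))).mono (by omega)
  · simp [Op.eval, h.reg, h.modulus]
  · rw [State.reg_setReg, if_pos rfl, State.reg_setReg, if_neg (by omega), h.residue]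
    rfl

/-- The cost `t` bounds both the number of instructions executed and the length of every number
handled. A load or store becomes three instructions, hence `3 * t`. An array number `y` has at most
`B` bits, so the new address `y * M + q` stays below `2 ^ B * M`. -/
theorem wp_relocate {inp : ℕ → ℕ → ℕ} {L B t : ℕ} {p : Prog} {σ' : State} (hb : 3 ≤ b)
    (hq : q < M) (hL : 2 ^ B * M ≤ 2 ^ L) (hrun : Runs inp p σ t σ') (ht : t ≤ B)
    (hR : p.regBound ≤ R) (h : Represents b M q σ τ) :
    WP inp L (p.relocate b) τ (3 * t) fun τ' =>
      Represents b M q σ' τ' ∧ RelocFrame b M q R τ τ' := by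
  have hBL : 2 ^ B ≤ 2 ^ L := le_trans (Nat.le_mul_of_pos_right _ (by omega)) hL
  have small : ∀ v : ℕ, v.size ≤ B → v < 2 ^ L := fun v hv => (Nat.size_le.1 hv).trans_le hBL
  induction hrun generalizing τ with
  | skip σ => exact (wp_skip ⟨h, .refl τ⟩).mono (by omega)
  | const σ x v =>
    simp only [Prog.regBound] at hR
    exact (wp_const (small v (by omega)) ⟨h.setReg hb x v, .setReg hb (by omega)⟩).mono (by omega)
  | op σ o x y z =>
    simp only [Prog.regBound, sup_le_iff] at hR
    exact (wp_op _ (by rw [h.reg, h.reg]) (small _ (by omega))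
      ⟨h.setReg hb x _, .setReg hb (by omega)⟩).mono (by omega)
  | input σ x y z =>
    simp only [Prog.regBound, sup_le_iff] at hR
    exact (wp_input _ (by rw [h.reg, h.reg]) (small _ (by omega))
      ⟨h.setReg hb x _, .setReg hb (by omega)⟩).mono (by omega)
  | load σ x y z =>
    simp only [Prog.regBound, sup_le_iff] at hR
    refine (wp_address (R := R) hb hq hL h (y := y) (Nat.size_le.1 (by omega)) ?_).mono
      (N := 2 + 1) (by omega)
    intro τ' h' hf ha
    exact wp_load _ (by rw [ha, h'.reg, h'.mem])
      ⟨h'.setReg hb x _, hf.trans (.setReg hb (by omega))⟩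
  | store σ y z x =>
    simp only [Prog.regBound, sup_le_iff] at hR
    refine (wp_address (R := R) hb hq hL h (y := y) (Nat.size_le.1 (by omega)) ?_).mono
      (N := 2 + 1) (by omega)
    intro τ' h' hf ha
    exact wp_store _ _ _ ha (h'.reg z) (h'.reg x) ⟨h'.setMem hq _ _ _, hf.trans (.setMem hq)⟩
  | @seq _ _ _ _ _ t t' _ _ ih1 ih2 =>
    simp only [Prog.regBound, sup_le_iff] at hR
    refine (wp_seq (N' := 3 * t') ((ih1 (by omega) hR.1 h).imp ?_)).mono (by omega)
    rintro τ' ⟨h', hf⟩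
    exact (ih2 (by omega) hR.2 h').imp fun τ'' h'' => ⟨h''.1, hf.trans h''.2⟩
  | ite_true hx _ ih =>
    simp only [Prog.regBound, sup_le_iff] at hR
    -- The branch that is not taken is contradictory, so it needs no budget.
    refine (wp_ite (N' := 0) (fun _ => ih (by omega) hR.2.1 h) fun h0 => ?_).mono (by omega)
    exact absurd (by rw [← h.reg, h0]) hx
  | ite_false hx _ ih =>
    simp only [Prog.regBound, sup_le_iff] at hR
    refine (wp_ite (N := 0) (fun h0 => ?_) fun _ => ih (by omega) hR.2.2 h).mono (by omega)
    exact absurd (by rw [h.reg, hx]) h0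
  | @loop_true _ _ _ _ _ t t' hx _ _ ih1 ih2 =>
    have hR' := hR
    simp only [Prog.regBound, sup_le_iff] at hR'
    refine (wp_loop_true (N' := 3 * t') (by rwa [h.reg]) ((ih1 (by omega) hR'.2 h).imp ?_)).mono (by omega)
    rintro τ' ⟨h', hf⟩
    exact (ih2 (by omega) hR h').imp fun τ'' h'' => ⟨h''.1, hf.trans h''.2⟩
  | loop_false hx =>
    exact (wp_loop_false (by rwa [h.reg]) ⟨h, .refl τ⟩).mono (by omega)

/-- Set the registers `b, …, b + R - 1` to zero. -/
def clear (b : ℕ) : ℕ → Prog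
  | 0 => .skip
  | R + 1 => clear b R ;; .const (b + R) 0

theorem wp_clear {inp : ℕ → ℕ → ℕ} {L : ℕ} (b R : ℕ) (σ : State) :
    WP inp L (clear b R) σ (R + 1) fun σ' => σ'.mem = σ.mem ∧
      ∀ r, σ'.reg r = if b ≤ r ∧ r < b + R then 0 else σ.reg r := by
  induction R with
  | zero => exact wp_skip ⟨rfl, fun r => by rw [if_neg (by omega)]⟩
  | succ R ih =>
    refine wp_seq (ih.imp ?_)
    rintro σ' ⟨hm, hr⟩
    refine wp_const (by positivity) ⟨hm, fun r => ?_⟩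
    rw [State.reg_setReg, hr]
    split_ifs <;> first | rfl | omega

/-- Call the program `E` with the contents of the registers `x` and `y` as its arguments. -/
def callProg (b : ℕ) (E : Prog) (x y : ℕ) : Prog :=
  clear b (E.regBound + 2) ;; .op .add b b x ;; .op .add (b + 1) (b + 1) y ;; E.relocate b

/-- The callee must find exactly the state `start [u, v]`. Its registers are cleared up to
`E.regBound + 2`, where the 2 covers the argument registers even if `E` does not name them. Beyond
that, registers are zero by `hhigh`, and the memory of the residue class `q` is zero by `hmem`. The
frame in the conclusion keeps these conditions available for later calls in other residue classes.
-/
theorem wp_callProg {inp : ℕ → ℕ → ℕ} {L B t x y u v : ℕ} {E : Prog} {σ' : State} (hb : 3 ≤ b)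
    (hq : q < M) (hL : 2 ^ B * M ≤ 2 ^ L) (hrun : Runs inp E (start [u, v]) t σ') (ht : t ≤ B)
    (hx : x < b) (hy : y < b) (hu : τ.reg x = u) (hv : τ.reg y = v)
    (hM : τ.reg (b - 3) = M) (hres : τ.reg (b - 2) = q)
    (hhigh : ∀ r, b + (E.regBound + 2) ≤ r → τ.reg r = 0)
    (hmem : ∀ a i, a % M = q → τ.mem a i = 0) :
    WP inp L (callProg b E x y) τ (E.regBound + 5 + 3 * B) fun τ' =>
      τ'.reg b = σ'.reg 0 ∧ RelocFrame b M q (E.regBound + 2) τ τ' := by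
  apply WP.of_bdd
  intro hbd
  refine (wp_seq ((wp_clear b _ τ).imp ?_)).mono (N := E.regBound + 2 + 1 + (1 + (1 + 3 * t)))
    (by omega)
  rintro τ₁ ⟨hm, hr⟩
  have hlow : ∀ r < b, τ₁.reg r = τ.reg r := fun r h => by rw [hr, if_neg (by omega)]
  refine wp_seq (wp_op u ?_ (hu ▸ hbd.reg x) (wp_seq (wp_op v ?_ (hv ▸ hbd.reg y) ?_)))
  · rw [hlow x hx, hu, hr, if_pos (by omega)]
    simp [Op.eval]
  · rw [State.reg_setReg, if_neg (by omega), State.reg_setReg, if_neg (by omega), hlow y hy, hv, hr,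
      if_pos (by omega)]
    simp [Op.eval]
  refine (wp_relocate (R := E.regBound + 2) (τ := (τ₁.setReg b u).setReg (b + 1) v) hb hq hL hrun ht
    (by omega) ⟨?_, ?_, ?_, ?_⟩).imp ?_
  · intro r
    rcases r with _ | _ | r
    · simp [start]
    · simp [start]
    · rw [State.reg_setReg, if_neg (by omega), State.reg_setReg, if_neg (by omega), hr]
      simp only [start]
      split_ifs
      · simp
      · rw [hhigh _ (by omega)]; simp
  · intro z
    funext i
    simp only [State.mem_setReg, hm, start]
    apply hmem
    rw [Nat.mul_add_mod_self_right, Nat.mod_eq_of_lt hq]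
  · rw [State.reg_setReg, if_neg (by omega), State.reg_setReg, if_neg (by omega), hlow _ (by omega),
      hM]
  · rw [State.reg_setReg, if_neg (by omega), State.reg_setReg, if_neg (by omega), hlow _ (by omega),
      hres]
  · rintro τ' ⟨h1, h2⟩
    refine ⟨by simpa using h1.reg 0, fun r h => ?_, fun r h => ?_, fun a h => ?_⟩
    · rw [h2.low r h, State.reg_setReg, if_neg (by omega), State.reg_setReg, if_neg (by omega),
        hlow _ (by omega)]
    · rw [h2.high r h, State.reg_setReg, if_neg (by omega), State.reg_setReg, if_neg (by omega), hr,
        if_neg (by omega)]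
    · rw [h2.mem a h, State.mem_setReg, State.mem_setReg, hm]

end RAM

/-! ### Truth values as numbers and sets as bit masks -/

namespace WSP

open Classical in
/-- The truth value of a proposition as a number. -/
noncomputable def ind (p : Prop) : ℕ := if p then 1 else 0

theorem ind_pos {p : Prop} (h : p) : ind p = 1 := if_pos h

theorem ind_neg {p : Prop} (h : ¬ p) : ind p = 0 := if_neg h

theorem ind_ne_zero {p : Prop} : ind p ≠ 0 ↔ p := by
  by_cases h : p <;> simp [ind, h]

theorem ind_eq_zero {p : Prop} : ind p = 0 ↔ ¬ p := by
  by_cases h : p <;> simp [ind, h]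

theorem ind_le_one (p : Prop) : ind p ≤ 1 := by
  by_cases h : p <;> simp [ind, h]

theorem ind_mul (p q : Prop) : ind p * ind q = ind (p ∧ q) := by
  by_cases h : p <;> by_cases h' : q <;> simp [ind, h, h']

theorem ind_congr {p q : Prop} (h : p ↔ q) : ind p = ind q := by rw [propext h]

section Mask

variable {k : ℕ}

theorem testBit_mask (F : Finset (Fin k)) (i : ℕ) :
    (mask F).testBit i = true ↔ ∃ s ∈ F, (s : ℕ) = i := by
  have h := Finset.toFinset_bitIndices_sum_two_pow (F.map Fin.valEmbedding)
  rw [Finset.sum_map] at h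
  rw [← Nat.mem_bitIndices, ← List.mem_toFinset]
  change i ∈ (∑ s ∈ F, 2 ^ (Fin.valEmbedding s)).bitIndices.toFinset ↔ _
  rw [h]
  simp

theorem testBit_mask_fin (F : Finset (Fin k)) (s : Fin k) :
    (mask F).testBit s = true ↔ s ∈ F := by
  rw [testBit_mask]
  exact ⟨fun ⟨s', h, e⟩ => Fin.ext e ▸ h, fun h => ⟨s, h, rfl⟩⟩

theorem mask_div_mod (F : Finset (Fin k)) (s : Fin k) :
    mask F / 2 ^ (s : ℕ) % 2 = ind (s ∈ F) := by
  have h := testBit_mask_fin F s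
  rw [Nat.testBit_eq_decide_div_mod_eq, decide_eq_true_iff] at h
  by_cases hs : s ∈ F
  · rw [h.2 hs, ind_pos hs]
  · rw [ind_neg hs]
    have := mt h.1 hs
    omega

theorem mask_lt (F : Finset (Fin k)) : mask F < 2 ^ k := by
  have := Nat.geomSum_lt (m := 2) (n := k) (s := F.map Fin.valEmbedding) le_rfl (by simp)
  rwa [Finset.sum_map] at this

theorem mask_injective : Function.Injective (mask (k := k)) := by
  intro F G h
  ext s
  rw [← testBit_mask_fin, h, testBit_mask_fin]

/-- By this, a loop over the numbers below `2 ^ k` is a loop over all sets of steps. -/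
theorem exists_mask_eq {m : ℕ} (h : m < 2 ^ k) : ∃ F : Finset (Fin k), mask F = m := by
  refine ⟨Finset.univ.filter fun s => m.testBit s = true, Nat.eq_of_testBit_eq fun i => ?_⟩
  rw [Bool.eq_iff_iff, testBit_mask]
  constructor
  · rintro ⟨s, hs, rfl⟩
    exact (Finset.mem_filter.1 hs).2
  · intro hi
    have hk : i < k := (Nat.pow_lt_pow_iff_right (by norm_num)).1
      ((Nat.ge_two_pow_of_testBit hi).trans_lt h)
    exact ⟨⟨i, hk⟩, by simpa using hi, rfl⟩

@[simp] theorem mask_empty : mask (∅ : Finset (Fin k)) = 0 := by simp [mask]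

theorem mask_eq_zero {F : Finset (Fin k)} : mask F = 0 ↔ F = ∅ := by
  rw [← mask_empty (k := k)]
  exact mask_injective.eq_iff

theorem mask_univ : mask (Finset.univ : Finset (Fin k)) = 2 ^ k - 1 := by
  rw [mask, Fin.sum_univ_eq_sum_range (fun i => 2 ^ i) k, Nat.geomSum_eq le_rfl]
  simp

theorem mask_sdiff {F Y : Finset (Fin k)} (h : Y ⊆ F) : mask (F \ Y) = mask F - mask Y := by
  have := Finset.sum_sdiff (f := fun s : Fin k => 2 ^ (s : ℕ)) h
  simp only [mask]
  omega

theorem mask_erase {F : Finset (Fin k)} {s : Fin k} (h : s ∈ F) :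
    mask (F.erase s) = mask F - 2 ^ (s : ℕ) := by
  rw [Finset.erase_eq, mask_sdiff (by simpa using h)]
  simp [mask]

theorem mask_insert {F : Finset (Fin k)} {s : Fin k} (h : s ∉ F) :
    mask (insert s F) = 2 ^ (s : ℕ) + mask F := by
  rw [mask, Finset.sum_insert h]
  rfl

/-- The elements of `F` less than `m`. -/
def below (F : Finset (Fin k)) (m : ℕ) : Finset (Fin k) := F.filter fun s => (s : ℕ) < m

theorem below_zero (F : Finset (Fin k)) : below F 0 = ∅ := by simp [below]

theorem below_top (F : Finset (Fin k)) : below F k = F := by simp [below]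

theorem notMem_below (F : Finset (Fin k)) {m : ℕ} (hm : m < k) : ⟨m, hm⟩ ∉ below F m := by
  simp [below]

theorem below_succ_of_mem {F : Finset (Fin k)} {m : ℕ} (hm : m < k) (h : ⟨m, hm⟩ ∈ F) :
    below F (m + 1) = insert ⟨m, hm⟩ (below F m) := by
  ext s
  simp only [below, Finset.mem_filter, Finset.mem_insert]
  constructor
  · rintro ⟨h1, h2⟩
    by_cases e : s = ⟨m, hm⟩
    · exact .inl e
    · have : (s : ℕ) ≠ m := fun e' => e (Fin.ext e')
      exact .inr ⟨h1, by omega⟩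
  · rintro (rfl | h1)
    · exact ⟨h, Nat.lt_succ_self _⟩
    · exact ⟨h1.1, by omega⟩

theorem below_succ_of_notMem {F : Finset (Fin k)} {m : ℕ} (hm : m < k) (h : ⟨m, hm⟩ ∉ F) :
    below F (m + 1) = below F m := by
  refine Finset.filter_congr fun s hs => ?_
  have : (s : ℕ) ≠ m := by
    rintro rfl
    exact h hs
  omega

end Mask

/-! ### Zeta transform and subset convolution -/

section Zeta

variable {k : ℕ}

open Classical in
/-- The sum of `f` over the subsets of `F` that differ from `F` only in elements less than `s`. -/
noncomputable def partialZeta (s : ℕ) (f : Finset (Fin k) → ℕ) (F : Finset (Fin k)) : ℕ :=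
  ∑ Y ∈ F.powerset with ∀ i ∈ F, i ∉ Y → (i : ℕ) < s, f Y

theorem partialZeta_zero (f : Finset (Fin k) → ℕ) (F : Finset (Fin k)) :
    partialZeta 0 f F = f F := by
  classical
  rw [partialZeta]
  have : (F.powerset.filter fun Y => ∀ i ∈ F, i ∉ Y → (i : ℕ) < 0) = {F} := by
    ext Y
    simp only [Finset.mem_filter, Finset.mem_powerset, Finset.mem_singleton, Nat.not_lt_zero,
      imp_false, not_not]
    exact ⟨fun h => h.1.antisymm h.2, fun h => by subst h; exact ⟨subset_rfl, fun _ => id⟩⟩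
  rw [this, Finset.sum_singleton]

theorem partialZeta_top (f : Finset (Fin k) → ℕ) (F : Finset (Fin k)) :
    partialZeta k f F = ∑ Y ∈ F.powerset, f Y := by
  simp [partialZeta]

theorem partialZeta_succ_of_notMem (f : Finset (Fin k) → ℕ) {F : Finset (Fin k)} {s : Fin k}
    (h : s ∉ F) : partialZeta (s + 1) f F = partialZeta s f F := by
  classical
  rw [partialZeta, partialZeta]
  congr 1
  refine Finset.filter_congr fun Y _ => forall₂_congr fun i hi => ?_
  have : (i : ℕ) ≠ s := fun e => h (Fin.ext e ▸ hi)
  exact imp_congr_right fun _ => by omega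

/-- The sum is split by whether `Y` contains `s`: the sets with `s` differ from `F` only below `s`,
and those without it differ from `F.erase s` only below `s`. This recursion is one sweep of the
transform. -/
theorem partialZeta_succ_of_mem (f : Finset (Fin k) → ℕ) {F : Finset (Fin k)} {s : Fin k}
    (h : s ∈ F) :
    partialZeta (s + 1) f F = partialZeta s f F + partialZeta s f (F.erase s) := by
  classical
  rw [partialZeta, ← Finset.sum_filter_add_sum_filter_not _ (fun Y => s ∈ Y), partialZeta,
    partialZeta, Finset.filter_filter]
  congr 2
  · refine Finset.filter_congr fun Y _ => ?_
    constructor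
    · rintro ⟨h1, h2⟩ i hi hY
      have : (i : ℕ) ≠ s := fun e => hY (Fin.ext e ▸ h2)
      have := h1 i hi hY
      omega
    · intro h1
      refine ⟨fun i hi hY => (h1 i hi hY).trans (Nat.lt_succ_self _), ?_⟩
      by_contra h2
      exact lt_irrefl _ (h1 s h h2)
  · ext Y
    simp only [Finset.mem_filter, Finset.mem_powerset, Finset.mem_erase, Finset.subset_erase]
    constructor
    · rintro ⟨⟨h1, h2⟩, h3⟩
      refine ⟨⟨h1, h3⟩, fun i hi hY => ?_⟩
      have := h2 i hi.2 hY
      have : (i : ℕ) ≠ s := fun e => hi.1 (Fin.ext e)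
      omega
    · rintro ⟨⟨h1, h3⟩, h2⟩
      refine ⟨⟨h1, fun i hi hY => ?_⟩, h3⟩
      by_cases e : i = s
      · subst e; omega
      · exact (h2 i ⟨e, hi⟩ hY).trans (Nat.lt_succ_self _)

theorem partialZeta_le {s : ℕ} {f : Finset (Fin k) → ℕ} {b : ℕ} (hf : ∀ F, f F ≤ b)
    (F : Finset (Fin k)) : partialZeta s f F ≤ 2 ^ k * b := by
  classical
  refine (Finset.sum_le_card_nsmul _ _ _ fun Y _ => hf Y).trans ?_
  rw [smul_eq_mul]
  refine Nat.mul_le_mul_right _ ((Finset.card_filter_le _ _).trans ?_)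
  rw [Finset.card_powerset]
  exact Nat.pow_le_pow_right (by norm_num) (by simpa using Finset.card_le_univ F)

open Classical in
/-- The covering product of two set functions. -/
noncomputable def unionProd (f g : Finset (Fin k) → ℕ) (V : Finset (Fin k)) : ℕ :=
  ∑ p : Finset (Fin k) × Finset (Fin k) with p.1 ∪ p.2 = V, f p.1 * g p.2

/-- Two sets both lie in `F` if and only if their union does; the pairs of subsets of `F` are
grouped by their union. -/
theorem partialZeta_unionProd (f g : Finset (Fin k) → ℕ) (F : Finset (Fin k)) :
    partialZeta k (unionProd f g) F = partialZeta k f F * partialZeta k g F := by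
  classical
  simp only [partialZeta_top, unionProd]
  rw [Finset.sum_mul_sum, ← Finset.sum_product', ← Finset.sum_fiberwise_of_maps_to
    (s := F.powerset ×ˢ F.powerset) (t := F.powerset) (g := fun p => p.1 ∪ p.2)]
  · refine Finset.sum_congr rfl fun V hV => ?_
    refine Finset.sum_congr ?_ fun _ _ => rfl
    ext p
    simp only [Finset.mem_filter, Finset.mem_univ, true_and, Finset.mem_product,
      Finset.mem_powerset] at hV ⊢
    refine ⟨fun h => ⟨?_, h⟩, fun h => h.2⟩
    rw [← Finset.union_subset_iff, h]
    exact hV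
  · intro p hp
    simp only [Finset.mem_product, Finset.mem_powerset] at hp ⊢
    exact Finset.union_subset hp.1 hp.2

/-- The indicator of a set family, weighted by a power of `2 ^ (k + 1)` that records the size. -/
noncomputable def weighted (f : Finset (Fin k) → Prop) (F : Finset (Fin k)) : ℕ :=
  ind (f F) * (2 ^ (k + 1)) ^ F.card

theorem weighted_le (f : Finset (Fin k) → Prop) (F : Finset (Fin k)) :
    weighted f F ≤ 2 ^ ((k + 1) * k) := by
  rw [weighted, pow_mul]
  have h1 : (2 ^ (k + 1)) ^ F.card ≤ (2 ^ (k + 1)) ^ k :=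
    Nat.pow_le_pow_right (by positivity) (by simpa using Finset.card_le_univ F)
  exact (Nat.mul_le_mul (ind_le_one _) h1).trans (one_mul _).le

/-- For `p.1 ∪ p.2 = V` the total size of the pair is `V.card` if it is disjoint and at least
`V.card + 1` otherwise, so overlapping pairs vanish modulo the next power of the base. A disjoint
pair is determined by its first member, so there are at most `2 ^ k` of them, fewer than the base,
and their count survives the reduction. -/
theorem unionProd_weighted_mod (f g : Finset (Fin k) → Prop) (V : Finset (Fin k)) :
    unionProd (weighted f) (weighted g) V % ((2 ^ (k + 1)) ^ V.card * 2 ^ (k + 1)) ≠ 0 ↔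
      ∃ Y ⊆ V, f Y ∧ g (V \ Y) := by
  classical
  set B := 2 ^ (k + 1) with hB
  have hBpos : 0 < B := by positivity
  rw [unionProd, ← Finset.sum_filter_add_sum_filter_not _ (fun p => Disjoint p.1 p.2)]
  set P := (Finset.univ.filter fun p : Finset (Fin k) × Finset (Fin k) => p.1 ∪ p.2 = V) with hP
  have hdvd : B ^ V.card * B ∣
      ∑ p ∈ P with ¬ Disjoint p.1 p.2, weighted f p.1 * weighted g p.2 := by
    refine Finset.dvd_sum fun p hp => ?_
    simp only [hP, Finset.mem_filter, Finset.mem_univ, true_and] at hp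
    have hc : V.card + 1 ≤ p.1.card + p.2.card := by
      have h1 := Finset.card_union_add_card_inter p.1 p.2
      rw [hp.1] at h1
      have h2 : 0 < (p.1 ∩ p.2).card := by
        rw [Finset.card_pos, ← Finset.not_disjoint_iff_nonempty_inter]
        exact hp.2
      omega
    rw [← pow_succ]
    refine (pow_dvd_pow B hc).trans ?_
    rw [weighted, weighted, pow_add, ← hB]
    exact mul_dvd_mul (Dvd.intro_left _ rfl) (Dvd.intro_left _ rfl)
  set D := (P.filter fun p => Disjoint p.1 p.2).filter fun p => f p.1 ∧ g p.2 with hD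
  have hsum : ∑ p ∈ P with Disjoint p.1 p.2, weighted f p.1 * weighted g p.2 =
      D.card * B ^ V.card := by
    rw [hD, Finset.card_filter, Finset.sum_mul]
    refine Finset.sum_congr rfl fun p hp => ?_
    simp only [hP, Finset.mem_filter, Finset.mem_univ, true_and] at hp
    rw [weighted, weighted, ← hp.1, Finset.card_union_of_disjoint hp.2, ← hB, pow_add]
    by_cases h1 : f p.1 <;> by_cases h2 : g p.2 <;> simp [ind, h1, h2]
  have hmem : ∀ p, p ∈ D ↔ p.1 ⊆ V ∧ p.2 = V \ p.1 ∧ f p.1 ∧ g p.2 := by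
    intro p
    simp only [hD, hP, Finset.mem_filter, Finset.mem_univ, true_and]
    constructor
    · rintro ⟨⟨h1, h2⟩, h3⟩
      subst h1
      exact ⟨Finset.subset_union_left, by rw [Finset.union_sdiff_cancel_left h2], h3⟩
    · rintro ⟨h1, h2, h3⟩
      refine ⟨⟨?_, ?_⟩, h3⟩
      · rw [h2, Finset.union_sdiff_of_subset h1]
      · rw [h2]; exact Finset.disjoint_sdiff
  have hcard : D.card < B := by
    have : D.card ≤ (Finset.univ : Finset (Finset (Fin k))).card := by
      refine Finset.card_le_card_of_injOn Prod.fst (fun _ _ => Finset.mem_coe.2 (Finset.mem_univ _))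
        ?_
      intro p hp p' hp' e
      rw [Finset.mem_coe, hmem] at hp hp'
      exact Prod.ext e (by rw [hp.2.1, hp'.2.1, e])
    rw [Finset.card_univ, Fintype.card_finset, Fintype.card_fin] at this
    refine this.trans_lt ?_
    rw [hB]
    exact Nat.pow_lt_pow_right (by norm_num) (by omega)
  obtain ⟨R, hR⟩ := hdvd
  rw [hsum, hR, Nat.add_mul_mod_self_left, Nat.mod_eq_of_lt, Nat.mul_ne_zero_iff]
  · rw [Finset.card_ne_zero]
    constructor
    · rintro ⟨⟨p, hp⟩, -⟩
      obtain ⟨h1, h2, h3, h4⟩ := (hmem p).1 hp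
      exact ⟨p.1, h1, h3, h2 ▸ h4⟩
    · rintro ⟨Y, h1, h2, h3⟩
      exact ⟨⟨(Y, V \ Y), (hmem _).2 ⟨h1, rfl, h2, h3⟩⟩, by positivity⟩
  · rw [mul_comm]
    exact Nat.mul_lt_mul_of_pos_left hcard (by positivity)

end Zeta

/-! ### Valid plans as divisions of the steps among the users -/

namespace Workflow

variable (W : Workflow)

/-- User number `u` exists and may perform the step `s`. -/
def AuthNat (s : Fin W.k) (u : ℕ) : Prop := ∃ h : u < W.n, W.auth s ⟨u, h⟩

/-- The set `Y` is empty or eligible for all constraints. -/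
def Admissible (Y : Finset (Fin W.k)) : Prop := Y = ∅ ∨ ∀ j, (W.con j).Eligible Y

/-- `Y` may be the set of all steps that user number `u` performs. -/
def Fits (u : ℕ) (Y : Finset (Fin W.k)) : Prop := W.Admissible Y ∧ ∀ s ∈ Y, W.AuthNat s u

/-- `C` can be divided among the first `i` users. -/
def Coverable : ℕ → Finset (Fin W.k) → Prop
  | 0, C => C = ∅
  | i + 1, C => ∃ Y ⊆ C, W.Fits i Y ∧ Coverable i (C \ Y)

variable {W}

theorem Valid.eligible {π : Plan W.k W.n} (h : W.Valid π) (j : Fin W.c) (s : Fin W.k) :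
    (W.con j).Eligible (π.block s) := fun hi => hi π ⟨s, rfl⟩ (h.2 j)

/-- The users below `i` cover the steps that `π` gives to them; user `i` adds a class of `π`, or the
empty set. -/
theorem Valid.coverable {π : Plan W.k W.n} (h : W.Valid π) :
    W.Coverable W.n Finset.univ := by
  classical
  suffices H : ∀ i ≤ W.n, W.Coverable i (Finset.univ.filter fun s => (π s : ℕ) < i) by
    simpa using H W.n le_rfl
  intro i
  induction i with
  | zero => intro _; simp [Coverable]
  | succ i ih =>
    intro hi
    refine ⟨Finset.univ.filter fun s => (π s : ℕ) = i, ?_, ⟨?_, ?_⟩, ?_⟩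
    · intro s
      simp only [Finset.mem_filter, Finset.mem_univ, true_and]
      omega
    · rcases Finset.eq_empty_or_nonempty (Finset.univ.filter fun s => (π s : ℕ) = i) with he | hne
      · exact .inl he
      · obtain ⟨s, hs⟩ := hne
        refine .inr fun j => ?_
        convert h.eligible j s using 1
        simp only [Finset.mem_filter, Finset.mem_univ, true_and] at hs
        ext s'
        simp [Plan.block, Fin.ext_iff, hs]
    · intro s hs
      simp only [Finset.mem_filter, Finset.mem_univ, true_and] at hs
      subst hs
      exact ⟨(π s).2, h.1 s⟩
    · convert ih (by omega) using 1
      ext s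
      simp only [Finset.mem_sdiff, Finset.mem_filter, Finset.mem_univ, true_and]
      omega

/-- This is where regularity enters: a class is nonempty, so being admissible makes it eligible for
each constraint. -/
theorem valid_of_fits (reg : ∀ j, (W.con j).Regular) {π : Plan W.k W.n}
    (h : ∀ s, W.Fits (π s) (π.block s)) : W.Valid π := by
  have self : ∀ s, s ∈ π.block s := fun s => by simp [Plan.block]
  refine ⟨fun s => ?_, fun j => reg j π fun s => ?_⟩
  · obtain ⟨_, ha⟩ := (h s).2 s (self s)
    exact ha
  · exact (h s).1.resolve_left (Finset.ne_empty_of_mem (self s)) j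

theorem input_auth (s : Fin W.k) {u : ℕ} (hu : u < W.n) :
    W.input 2 (s * W.n + u) = ind (W.AuthNat s u) := by
  rw [input, ind]
  congr 1
  rw [eq_iff_iff]
  constructor
  · rintro ⟨s', u', e, ha⟩
    have h1 : (s : ℕ) = s' := by
      have := congrArg (· / W.n) e
      simpa [Nat.add_div_of_dvd_right, hu.pos, Nat.div_eq_of_lt hu,
        Nat.div_eq_of_lt u'.2] using this
    have h2 : u = u' := by rw [h1] at e; omega
    obtain rfl := Fin.ext h1
    subst h2
    exact ⟨hu, ha⟩
  · rintro ⟨_, ha⟩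
    exact ⟨s, ⟨u, hu⟩, rfl, ha⟩

end Workflow

/-! ### Constants of the solver and routines on single sets -/

open RAM

/-- The constants that the solver keeps in its first registers. -/
structure Env (W : Workflow) (σ : State) : Prop where
  zero : σ.reg 0 = 0
  one : σ.reg 1 = 1
  steps : σ.reg 2 = W.k
  users : σ.reg 3 = W.n
  constraints : σ.reg 4 = W.c
  two : σ.reg 5 = 2
  sets : σ.reg 6 = 2 ^ W.k
  modulus : σ.reg 7 = 2 ^ W.k * W.c + 1
  base : σ.reg 8 = 2 ^ (W.k + 1)

theorem Env.congr {W : Workflow} {σ σ' : State} (h : Env W σ)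
    (e : ∀ r < 10, σ'.reg r = σ.reg r) : Env W σ' := by
  obtain ⟨h0, h1, h2, h3, h4, h5, h6, h7, h8⟩ := h
  constructor <;> rw [e _ (by norm_num)] <;> assumption

/-- Numbers of `L` bits suffice for the solver, if `B` is the cost of an eligibility test. -/
structure Large (W : Workflow) (B L : ℕ) : Prop where
  small : 2 * W.n + 8 ≤ 2 ^ L
  index : W.k * W.n ≤ 2 ^ L
  square : 2 ^ W.k * 2 ^ ((W.k + 1) * W.k) * (2 ^ W.k * 2 ^ ((W.k + 1) * W.k)) < 2 ^ L
  weight : 2 ^ ((W.k + 1) * (W.k + 1)) < 2 ^ L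
  call : 2 ^ B * (2 ^ W.k * W.c + 1) < 2 ^ L

theorem Large.pow_lt {W : Workflow} {B L m : ℕ} (h : Large W B L) (hm : m ≤ W.k + 1) :
    2 ^ m < 2 ^ L := by
  refine lt_of_le_of_lt (Nat.pow_le_pow_right (by norm_num) ?_) h.weight
  nlinarith

theorem Large.zeta_lt {W : Workflow} {B L : ℕ} (h : Large W B L) :
    2 ^ W.k * 2 ^ ((W.k + 1) * W.k) < 2 ^ L :=
  lt_of_le_of_lt (Nat.le_mul_of_pos_left _ (by positivity)) h.square

/-- `r := (x / p) % 2` -/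
def bitProg (x p r : ℕ) : Prog :=
  .op .div r x p ;; .op .div (r + 1) r 5 ;; .op .mul (r + 1) (r + 1) 5 ;; .op .sub r r (r + 1)

section

variable {inp : ℕ → ℕ → ℕ} {W : Workflow} {B L : ℕ} {σ : State}

theorem wp_bitProg {x p r : ℕ} {F : Finset (Fin W.k)} {s : Fin W.k}
    (h2 : σ.reg 5 = 2) (hx : σ.reg x = mask F) (hp : σ.reg p = 2 ^ (s : ℕ)) (hr : 5 < r) :
    WP inp L (bitProg x p r) σ 4 fun σ' =>
      (∀ r' < r, σ'.reg r' = σ.reg r') ∧ σ'.mem = σ.mem ∧ σ'.reg r = ind (s ∈ F) := by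
  apply WP.of_bdd
  intro hb
  set v := mask F / 2 ^ (s : ℕ) with hv
  have hvL : v < 2 ^ L := (Nat.div_le_self _ _).trans_lt (hx ▸ hb.reg x)
  have hd := Nat.div_add_mod v 2
  refine wp_seq (N' := 3) (wp_div v (by rw [hx, hp]) (wp_seq (N' := 2) (wp_div (v / 2) ?_
    (wp_seq (N' := 1) (wp_op (v / 2 * 2) ?_ (by omega) (wp_sub (v % 2) ?_ ⟨?_, rfl, ?_⟩))))))
  · simp [h2, hr.ne]
  · have : ¬ 5 = r + 1 := by omega
    simp [Op.eval, h2, hr.ne, this]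
  · simp
    omega
  · intro r' hr'
    have h1 : r' ≠ r := hr'.ne
    have h2 : r' ≠ r + 1 := by omega
    simp [h1, h2]
  · simp [hv, mask_div_mod]

/-- Register 43 becomes 1 if the set in register `x` is a subset of that in register `y`, and 0
otherwise. -/
def subsetProg (x y : ℕ) : Prog :=
  .const 42 1 ;; .const 43 1 ;;
    forLoop 40 2 (bitProg x 42 44 ;; bitProg y 42 46 ;;
      .ite 44 (.ite 46 .skip (.const 43 0)) .skip ;; .op .mul 42 42 5)

theorem wp_subsetProg (hE : Env W σ) (hL : Large W B L) {x y : ℕ} {F G : Finset (Fin W.k)}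
    (hx : σ.reg x = mask F) (hy : σ.reg y = mask G) (hx' : x < 40) (hy' : y < 40) :
    WP inp L (subsetProg x y) σ (17 * W.k + 5) fun σ' =>
      (∀ r < 40, σ'.reg r = σ.reg r) ∧ σ'.mem = σ.mem ∧ σ'.reg 43 = ind (F ⊆ G) := by
  have hs := hL.small
  refine (wp_seq (wp_const (by omega) (wp_seq (wp_const (by omega)
    (wp_forLoop (fun m σ' => σ'.mem = σ.mem ∧ σ'.reg 42 = 2 ^ m ∧
      σ'.reg 43 = ind (∀ s ∈ F, (s : ℕ) < m → s ∈ G)) W.k 14 (by simp [hE.steps])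
      (by simp [hE.one]) (by norm_num) (by norm_num) ?_ ?_ ?_ ?_))))).mono (by omega)
  · rintro m τ v w ⟨h1, h2, h3⟩
    exact ⟨h1, by simpa using h2, by simpa using h3⟩
  · refine ⟨rfl, by simp, ?_⟩
    rw [ind_pos (by simp)]
    simp
  · rintro m τ hm hi hfr ⟨h1, h2, h3⟩
    have h5 : τ.reg 5 = 2 := by simp [hfr 5, hE.two]
    have hxF : τ.reg x = mask F := by
      rw [hfr x hx', State.reg_setReg, State.reg_setReg, if_neg (by omega), if_neg (by omega), hx]
    have hyG : τ.reg y = mask G := by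
      rw [hfr y hy', State.reg_setReg, State.reg_setReg, if_neg (by omega), if_neg (by omega), hy]
    refine wp_seq (N := 4) (N' := 10) ((wp_bitProg (s := ⟨m, hm⟩) h5 hxF h2 (by norm_num)).imp ?_)
    rintro τ₁ ⟨f1, m1, b1⟩
    refine wp_seq (N := 4) (N' := 6) ((wp_bitProg (s := ⟨m, hm⟩) (F := G) ((f1 5 (by norm_num)).trans h5)
      ((f1 y (by omega)).trans hyG) ((f1 42 (by norm_num)).trans h2) (by norm_num)).imp ?_)
    rintro τ₂ ⟨f2, m2, b2⟩
    have hstep : ∀ τ₃ : State, (∀ r < 43, τ₃.reg r = τ₂.reg r) → τ₃.mem = τ₂.mem →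
        τ₃.reg 43 = ind (∀ s ∈ F, (s : ℕ) < m + 1 → s ∈ G) →
        WP inp L (.op .mul 42 42 5) τ₃ 1 fun σ' => (∀ r ≤ 40, σ'.reg r = τ.reg r) ∧
          σ'.mem = σ.mem ∧ σ'.reg 42 = 2 ^ (m + 1) ∧
            σ'.reg 43 = ind (∀ s ∈ F, (s : ℕ) < m + 1 → s ∈ G) := by
      intro τ₃ f3 m3 b3
      refine wp_op (2 ^ (m + 1)) ?_ (hL.pow_lt (by omega)) ⟨fun r hr => ?_, ?_, by simp, b3⟩
      · rw [f3 _ (by norm_num), f3 _ (by norm_num), f2 _ (by norm_num), f2 _ (by norm_num),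
          f1 _ (by norm_num), f1 _ (by norm_num), h2, h5, pow_succ]
        rfl
      · rw [State.reg_setReg, if_neg (by omega), f3 _ (by omega), f2 _ (by omega), f1 _ (by omega)]
      · rw [State.mem_setReg, m3, m2, m1, h1]
    have h43 : τ₂.reg 43 = ind (∀ s ∈ F, (s : ℕ) < m → s ∈ G) := by
      rw [f2 _ (by norm_num), f1 _ (by norm_num), h3]
    have h44 : τ₂.reg 44 = ind ((⟨m, hm⟩ : Fin W.k) ∈ F) := by rw [f2 _ (by norm_num), b1]
    have extend : ((⟨m, hm⟩ : Fin W.k) ∈ F → (⟨m, hm⟩ : Fin W.k) ∈ G) →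
        ((∀ s ∈ F, (s : ℕ) < m → s ∈ G) ↔ ∀ s ∈ F, (s : ℕ) < m + 1 → s ∈ G) := by
      refine fun h => ⟨fun h' s hs hsm => ?_, fun h' s hs hsm => h' s hs (by omega)⟩
      rcases Nat.lt_succ_iff_lt_or_eq.1 hsm with h'' | h''
      · exact h' s hs h''
      · obtain rfl : s = ⟨m, hm⟩ := Fin.ext h''
        exact h hs
    refine wp_seq (N := 5) (N' := 1) ((wp_ite (N := 3) (N' := 1) (fun h => wp_ite (N := 1) (N' := 1)
      (fun h' => ?_) fun h' => ?_) fun h => ?_))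
    · rw [b2, ind_ne_zero] at h'
      exact wp_skip (hstep _ (fun _ _ => rfl) rfl (h43.trans (ind_congr (extend fun _ => h'))))
    · rw [b2, ind_eq_zero] at h'
      rw [h44, ind_ne_zero] at h
      refine wp_const (by positivity) (hstep _ (fun r hr => ?_) rfl ?_)
      · rw [State.reg_setReg, if_neg (by omega)]
      · rw [State.reg_setReg, if_pos rfl, ind_neg]
        exact fun hall => h' (hall _ h (Nat.lt_succ_self m))
    · rw [h44, ind_eq_zero] at h
      exact wp_skip (hstep _ (fun _ _ => rfl) rfl
        (h43.trans (ind_congr (extend fun h' => absurd h' h))))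
  · rintro τ hfr ⟨h1, -, h3⟩
    refine ⟨fun r hr => ?_, h1, h3.trans (ind_congr ?_)⟩
    · rw [hfr r hr, State.reg_setReg, State.reg_setReg, if_neg (by omega), if_neg (by omega)]
    · exact ⟨fun h s hs => h s hs s.2, fun h s hs _ => h hs⟩

/-! ### Tables indexed by sets, and transforms in place -/

/-- For all sets, run `body` and store its result, register `v`, into the array whose number is in
register `arr`; the set is in register 30. -/
def fillProg (arr v : ℕ) (body : Prog) : Prog := forLoop 30 6 (body ;; .store arr 30 v)

/-- The body may rely on the old entry of `F` in the target array, so the target may also be a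
source, as in products formed in place. -/
theorem wp_fillProg (hE : Env W σ) {arr v a N : ℕ} {body : Prog} (val : Finset (Fin W.k) → ℕ)
    (ha : σ.reg arr = a) (harr : arr < 30)
    (hbody : ∀ τ F, (∀ r < 30, τ.reg r = σ.reg r) → τ.reg 30 = mask F →
      (∀ a', a' ≠ a → τ.mem a' = σ.mem a') → τ.mem a (mask F) = σ.mem a (mask F) →
      WP inp L body τ N fun τ' =>
        (∀ r ≤ 30, τ'.reg r = τ.reg r) ∧ τ'.mem = τ.mem ∧ τ'.reg v = val F) :
    WP inp L (fillProg arr v body) σ (2 ^ W.k * (N + 4) + 3) fun σ' =>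
      (∀ r < 30, σ'.reg r = σ.reg r) ∧ (∀ a', a' ≠ a → σ'.mem a' = σ.mem a') ∧
        ∀ F : Finset (Fin W.k), σ'.mem a (mask F) = val F := by
  refine wp_forLoop (fun m σ' => (∀ a', a' ≠ a → σ'.mem a' = σ.mem a') ∧
    ∀ F : Finset (Fin W.k), σ'.mem a (mask F) = if mask F < m then val F else σ.mem a (mask F))
    (2 ^ W.k) (N + 1) hE.sets hE.one (by norm_num) (by norm_num) (fun _ _ _ _ h => h) ?_ ?_ ?_
  · exact ⟨fun _ _ => rfl, fun F => by simp⟩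
  · rintro m τ hm hi hfr ⟨h1, h2⟩
    obtain ⟨F, rfl⟩ := exists_mask_eq hm
    refine wp_seq ((hbody τ F hfr hi h1 (by rw [h2, if_neg (lt_irrefl _)])).imp ?_)
    rintro τ' ⟨f1, m1, v1⟩
    refine wp_store a (mask F) (val F) ?_ ?_ v1 ⟨f1, fun a' ha' => ?_, fun G => ?_⟩
    · rw [f1 _ (by omega), hfr _ harr, ha]
    · rw [f1 _ le_rfl, hi]
    · rw [State.mem_setMem_of_ne _ ha', m1, h1 a' ha']
    · rw [State.mem_setMem]
      by_cases e : G = F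
      · subst e; simp
      · have e' : mask G ≠ mask F := fun h => e (mask_injective h)
        rw [if_neg (by simp [e']), m1, h2]
        split_ifs <;> first | rfl | omega
  · rintro τ hfr ⟨h1, h2⟩
    exact ⟨hfr, h1, fun F => by rw [h2, if_pos (mask_lt F)]⟩

/-- Combine, by the operation `o`, the entries of all sets that contain an element with those of the
sets without it; the array is given by register `arr`, and register 22 holds two to the power of the
element. -/
def sweepProg (o : Op) (arr : ℕ) : Prog :=
  forLoop 30 6 (bitProg 30 22 32 ;;
    .ite 32 (.op .sub 34 30 22 ;; .load 34 arr 34 ;; .load 35 arr 30 ;; .op o 34 35 34 ;;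
      .store arr 30 34) .skip)

/-- Working in place is harmless: the entry of `F.erase s` is visited before that of `F`, but a
sweep does not alter entries of sets without `s`. -/
theorem wp_sweepProg (hE : Env W σ) {o : Op} {arr a : ℕ} {s : Fin W.k}
    (f g : Finset (Fin W.k) → ℕ) (harr : arr < 30) (ha : σ.reg arr = a)
    (hp : σ.reg 22 = 2 ^ (s : ℕ)) (hf : ∀ F, σ.mem a (mask F) = f F)
    (hnot : ∀ F, s ∉ F → g F = f F) (hmem : ∀ F, s ∈ F → o.eval (f F) (f (F.erase s)) = g F)
    (hg : ∀ F, g F < 2 ^ L) :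
    WP inp L (sweepProg o arr) σ (2 ^ W.k * 14 + 3) fun σ' =>
      (∀ r < 30, σ'.reg r = σ.reg r) ∧ (∀ a', a' ≠ a → σ'.mem a' = σ.mem a') ∧
        ∀ F, σ'.mem a (mask F) = g F := by
  refine wp_forLoop (fun m σ' => (∀ a', a' ≠ a → σ'.mem a' = σ.mem a') ∧
    ∀ F : Finset (Fin W.k), σ'.mem a (mask F) = if mask F < m then g F else f F)
    (2 ^ W.k) 11 hE.sets hE.one (by norm_num) (by norm_num) (fun _ _ _ _ h => h) ?_ ?_ ?_
  · exact ⟨fun _ _ => rfl, fun F => by simp [hf]⟩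
  · rintro m τ hm hi hfr ⟨h1, h2⟩
    obtain ⟨F, rfl⟩ := exists_mask_eq hm
    refine wp_seq (N := 4) (N' := 7) ((wp_bitProg (s := s) (F := F) ((hfr 5 (by norm_num)).trans hE.two)
      hi ((hfr 22 (by norm_num)).trans hp) (by norm_num)).imp ?_)
    rintro τ₁ ⟨f1, m1, b1⟩
    have hstep : ∀ τ' : State, (∀ a', a' ≠ a → τ'.mem a' = τ.mem a') →
        (∀ G, G ≠ F → τ'.mem a (mask G) = τ.mem a (mask G)) → τ'.mem a (mask F) = g F →
        (∀ a', a' ≠ a → τ'.mem a' = σ.mem a') ∧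
        ∀ G : Finset (Fin W.k), τ'.mem a (mask G) = if mask G < mask F + 1 then g G else f G := by
      intro τ' k1 k2 k3
      refine ⟨fun a' ha' => (k1 a' ha').trans (h1 a' ha'), fun G => ?_⟩
      by_cases e : G = F
      · subst e; simp [k3]
      · have e' : mask G ≠ mask F := fun h => e (mask_injective h)
        rw [k2 G e, h2]
        split_ifs <;> first | rfl | omega
    have harr1 : τ₁.reg arr = a := by rw [f1 _ (by omega), hfr _ harr, ha]
    have h30 : τ₁.reg 30 = mask F := by rw [f1 _ (by norm_num), hi]
    have h22 : τ₁.reg 22 = 2 ^ (s : ℕ) := by rw [f1 _ (by norm_num), hfr _ (by norm_num), hp]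
    refine wp_ite (N := 5) (N' := 1) (fun h => ?_) fun h => ?_
    · rw [b1, ind_ne_zero] at h
      have hold : τ.mem a (mask F) = f F := by rw [h2, if_neg (lt_irrefl _)]
      have herase : τ.mem a (mask (F.erase s)) = f (F.erase s) := by
        rw [h2, hnot _ (Finset.notMem_erase s F), ite_self]
      have n34 : arr ≠ 34 := by omega
      have n35 : arr ≠ 35 := by omega
      refine wp_seq (N := 1) (N' := 4) (wp_sub (mask (F.erase s)) (by rw [mask_erase h, h30, h22]) ?_)
      refine wp_seq (N := 1) (N' := 3) (wp_load (f (F.erase s)) ?_ ?_)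
      · simp [n34, harr1, m1, herase]
      refine wp_seq (N := 1) (N' := 2) (wp_load (f F) ?_ ?_)
      · simp [n34, harr1, m1, hold, h30]
      refine wp_seq (N := 1) (N' := 1) (wp_op (g F) ?_ (hg F) ?_)
      · simp [hmem F h]
      refine wp_store a (mask F) (g F) (by simp [n34, n35, harr1]) (by simp [h30]) (by simp)
        ⟨fun r hr => ?_, hstep _ (fun a' ha' => ?_) (fun G hG => ?_) ?_⟩
      · have q1 : r ≠ 34 := by omega
        have q2 : r ≠ 35 := by omega
        simp [q1, q2, f1 r (by omega)]
      · rw [State.mem_setMem_of_ne _ ha']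
        simp [m1]
      · rw [State.mem_setMem, if_neg (fun h => hG (mask_injective h.2))]
        simp [m1]
      · simp [State.mem_setMem]
    · rw [b1, ind_eq_zero] at h
      refine wp_skip ⟨fun r hr => f1 r (by omega), hstep _ (fun _ _ => by rw [m1])
        (fun _ _ => by rw [m1]) ?_⟩
      rw [m1, h2, if_neg (lt_irrefl _), hnot F h]
  · rintro τ hfr ⟨h1, h2⟩
    exact ⟨hfr, h1, fun F => by rw [h2, if_pos (mask_lt F)]⟩

/-- The zeta transform of the array given by register `arr`. -/
def zetaProg (arr : ℕ) : Prog :=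
  .const 22 1 ;; forLoop 20 2 (sweepProg .add arr ;; .op .mul 22 22 5)

theorem wp_zetaProg (hE : Env W σ) (hL : Large W B L) {arr a : ℕ} (f : Finset (Fin W.k) → ℕ)
    (harr : arr < 20) (ha : σ.reg arr = a) (hf : ∀ F, σ.mem a (mask F) = f F)
    (hle : ∀ F, f F ≤ 2 ^ ((W.k + 1) * W.k)) :
    WP inp L (zetaProg arr) σ (W.k * (2 ^ W.k * 14 + 7) + 4) fun σ' =>
      (∀ r < 20, σ'.reg r = σ.reg r) ∧ (∀ a', a' ≠ a → σ'.mem a' = σ.mem a') ∧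
        ∀ F, σ'.mem a (mask F) = partialZeta W.k f F := by
  have hs := hL.small
  refine (wp_seq (wp_const (by omega) (wp_forLoop (fun m σ' => σ'.reg 22 = 2 ^ m ∧
    (∀ a', a' ≠ a → σ'.mem a' = σ.mem a') ∧
      ∀ F : Finset (Fin W.k), σ'.mem a (mask F) = partialZeta m f F)
    W.k (2 ^ W.k * 14 + 4) (by simp [hE.steps]) (by simp [hE.one]) (by norm_num) (by norm_num)
    ?_ ?_ ?_ ?_))).mono (le_of_eq (by ring))
  · rintro m τ v w ⟨h1, h2⟩
    exact ⟨by simpa using h1, h2⟩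
  · exact ⟨by simp, fun _ _ => rfl, fun F => by simp [hf, partialZeta_zero]⟩
  · rintro m τ hm hi hfr ⟨h1, h2, h3⟩
    have hfr' : ∀ r < 20, τ.reg r = σ.reg r := fun r hr => by
      rw [hfr r hr, State.reg_setReg, if_neg (by omega)]
    have hEτ := hE.congr fun r hr => hfr' r (by omega)
    refine wp_seq (N := 2 ^ W.k * 14 + 3) (N' := 1) ((wp_sweepProg hEτ (o := .add) (s := ⟨m, hm⟩) (a := a)
      (partialZeta m f) (partialZeta (m + 1) f) (by omega) ((hfr' arr harr).trans ha) h1 h3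
      (fun F h => partialZeta_succ_of_notMem f h)
      (fun F h => (partialZeta_succ_of_mem f h).symm)
      (fun F => (partialZeta_le hle F).trans_lt hL.zeta_lt)).imp ?_)
    rintro τ₁ ⟨f1, m1, v1⟩
    refine wp_op (2 ^ (m + 1)) ?_ (hL.pow_lt (by omega)) ⟨fun r hr => ?_, by simp, ?_, v1⟩
    · rw [f1 _ (by norm_num), f1 _ (by norm_num), h1, hEτ.two, pow_succ]
      rfl
    · rw [State.reg_setReg, if_neg (by omega), f1 _ (by omega)]
    · exact fun a' ha' => (m1 a' ha').trans (h2 a' ha')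
  · rintro τ hfr ⟨-, h2, h3⟩
    refine ⟨fun r hr => ?_, h2, h3⟩
    rw [hfr r hr, State.reg_setReg, if_neg (by omega)]

/-- The Möbius transform of the array given by register `arr`. -/
def moebiusProg (arr : ℕ) : Prog :=
  .op .add 22 6 0 ;; forLoop 20 2 (.op .div 22 22 5 ;; sweepProg .sub arr)

/-- The sweeps of the zeta transform are undone in reverse order, with no alternating sums. By
`partialZeta_succ_of_mem` each difference is a smaller partial sum, so truncated subtraction is
exact. -/
theorem wp_moebiusProg (hE : Env W σ) {arr a : ℕ} (f : Finset (Fin W.k) → ℕ)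
    (harr : arr < 20) (ha : σ.reg arr = a)
    (hf : ∀ F, σ.mem a (mask F) = partialZeta W.k f F) (hlt : ∀ s F, partialZeta s f F < 2 ^ L) :
    WP inp L (moebiusProg arr) σ (W.k * (2 ^ W.k * 14 + 7) + 4) fun σ' =>
      (∀ r < 20, σ'.reg r = σ.reg r) ∧ (∀ a', a' ≠ a → σ'.mem a' = σ.mem a') ∧
        ∀ F, σ'.mem a (mask F) = f F := by
  apply WP.of_bdd
  intro hb
  refine (wp_seq (wp_op (2 ^ W.k) (by simp [Op.eval, hE.sets, hE.zero]) (hE.sets ▸ hb.reg 6)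
    (wp_forLoop (fun m σ' => σ'.reg 22 = 2 ^ (W.k - m) ∧
    (∀ a', a' ≠ a → σ'.mem a' = σ.mem a') ∧
      ∀ F : Finset (Fin W.k), σ'.mem a (mask F) = partialZeta (W.k - m) f F)
    W.k (2 ^ W.k * 14 + 4) (by simp [hE.steps]) (by simp [hE.one]) (by norm_num) (by norm_num)
    ?_ ?_ ?_ ?_))).mono (le_of_eq (by ring))
  · rintro m τ v w ⟨h1, h2⟩
    exact ⟨by simpa using h1, h2⟩
  · exact ⟨by simp, fun _ _ => rfl, fun F => by simp [hf]⟩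
  · rintro m τ hm hi hfr ⟨h1, h2, h3⟩
    have hfr' : ∀ r < 20, τ.reg r = σ.reg r := fun r hr => by
      rw [hfr r hr, State.reg_setReg, if_neg (by omega)]
    have hEτ := hE.congr fun r hr => hfr' r (by omega)
    obtain ⟨s, hs⟩ : ∃ s, W.k - m = s + 1 := ⟨W.k - m - 1, by omega⟩
    have hs' : W.k - (m + 1) = s := by omega
    rw [hs] at h1 h3
    rw [hs']
    refine (wp_seq (N := 1) (N' := 2 ^ W.k * 14 + 3) (wp_div (2 ^ s) ?_ ?_)).mono (by omega)
    · rw [h1, hEτ.two, pow_succ]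
      simp
    have hfr₁ : ∀ r < 20, (τ.setReg 22 (2 ^ s)).reg r = τ.reg r := fun r hr => by
      rw [State.reg_setReg, if_neg (by omega)]
    refine (wp_sweepProg (hEτ.congr fun r hr => hfr₁ r (by omega)) (s := ⟨s, by omega⟩) (a := a)
      (partialZeta (s + 1) f) (partialZeta s f) (by omega)
      (by rw [hfr₁ arr harr, hfr' arr harr, ha]) (by simp) h3
      (fun F h => (partialZeta_succ_of_notMem f h).symm)
      (fun F h => ?_) (hlt s)).imp ?_
    · have e1 := partialZeta_succ_of_mem f h
      have e2 := partialZeta_succ_of_notMem f (Finset.notMem_erase (⟨s, by omega⟩ : Fin W.k) F)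
      simp only at e1 e2
      rw [e1, e2, Op.eval]
      omega
    rintro τ₁ ⟨f1, m1, v1⟩
    refine ⟨fun r hr => ?_, ?_, ?_, v1⟩
    · rw [f1 _ (by omega), State.reg_setReg, if_neg (by omega)]
    · rw [f1 _ (by norm_num)]
      simp
    · exact fun a' ha' => (m1 a' ha').trans (h2 a' ha')
  · rintro τ hfr ⟨-, h2, h3⟩
    refine ⟨fun r hr => ?_, h2, fun F => by rw [h3, Nat.sub_self, partialZeta_zero]⟩
    rw [hfr r hr, State.reg_setReg, if_neg (by omega)]

end

/-- This bounds the intermediate values of the Möbius transform by the values it starts from. -/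
theorem partialZeta_le_top {k : ℕ} (s : ℕ) (f : Finset (Fin k) → ℕ) (F : Finset (Fin k)) :
    partialZeta s f F ≤ partialZeta k f F := by
  classical
  rw [partialZeta_top, partialZeta]
  exact Finset.sum_le_sum_of_subset (Finset.filter_subset _ _)

/-! ### The program for subset convolution -/

section

variable {inp : ℕ → ℕ → ℕ} {W : Workflow} {B L : ℕ} {σ : State}

/-- Array 1 is filled with the weights of all sets. -/
def weightProg : Prog :=
  fillProg 1 43 (.const 42 1 ;; .const 43 1 ;;
    forLoop 40 2 (bitProg 30 42 44 ;; .ite 44 (.op .mul 43 43 8) .skip ;; .op .mul 42 42 5))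

theorem wp_weightProg (hE : Env W σ) (hL : Large W B L) :
    WP inp L weightProg σ (2 ^ W.k * (W.k * 11 + 9) + 3) fun σ' =>
      (∀ r < 30, σ'.reg r = σ.reg r) ∧ (∀ a, a ≠ 1 → σ'.mem a = σ.mem a) ∧
        ∀ F : Finset (Fin W.k), σ'.mem 1 (mask F) = (2 ^ (W.k + 1)) ^ F.card := by
  have hs := hL.small
  refine wp_fillProg (N := W.k * 11 + 5) hE _ hE.one (by norm_num) fun τ F hfr hF _ _ => ?_
  refine (wp_seq (wp_const (by omega) (wp_seq (wp_const (by omega)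
    (wp_forLoop (fun m τ' => τ'.mem = τ.mem ∧ τ'.reg 42 = 2 ^ m ∧
      τ'.reg 43 = (2 ^ (W.k + 1)) ^ (below F m).card) W.k 8
      (by simp [hfr, hE.steps]) (by simp [hfr, hE.one]) (by norm_num) (by norm_num)
      ?_ ?_ ?_ ?_))))).mono (by omega)
  · rintro m τ' v w ⟨h1, h2, h3⟩
    exact ⟨h1, by simpa using h2, by simpa using h3⟩
  · exact ⟨rfl, by simp, by simp [below_zero]⟩
  · rintro m τ' hm hi hfr' ⟨h1, h2, h3⟩
    have h5 : τ'.reg 5 = 2 := by simp [hfr' 5, hfr, hE.two]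
    have h8 : τ'.reg 8 = 2 ^ (W.k + 1) := by simp [hfr' 8, hfr, hE.base]
    have h30 : τ'.reg 30 = mask F := by simp [hfr' 30, hF]
    refine wp_seq (N := 4) (N' := 4) ((wp_bitProg (s := ⟨m, hm⟩) h5 h30 h2 (by norm_num)).imp ?_)
    rintro τ₁ ⟨f1, m1, b1⟩
    have hstep : ∀ τ₃ : State, (∀ r < 43, τ₃.reg r = τ₁.reg r) → τ₃.mem = τ₁.mem →
        τ₃.reg 43 = (2 ^ (W.k + 1)) ^ (below F (m + 1)).card →
        WP inp L (.op .mul 42 42 5) τ₃ 1 fun σ' => (∀ r ≤ 40, σ'.reg r = τ'.reg r) ∧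
          σ'.mem = τ.mem ∧ σ'.reg 42 = 2 ^ (m + 1) ∧
            σ'.reg 43 = (2 ^ (W.k + 1)) ^ (below F (m + 1)).card := by
      intro τ₃ f3 m3 b3
      refine wp_op (2 ^ (m + 1)) ?_ (hL.pow_lt (by omega)) ⟨fun r hr => ?_, ?_, by simp, b3⟩
      · rw [f3 _ (by norm_num), f3 _ (by norm_num), f1 _ (by norm_num), f1 _ (by norm_num), h2, h5,
          pow_succ]
        rfl
      · rw [State.reg_setReg, if_neg (by omega), f3 _ (by omega), f1 _ (by omega)]
      · rw [State.mem_setReg, m3, m1, h1]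
    refine wp_seq (N := 3) (N' := 1) (wp_ite (N := 1) (N' := 1) (fun h => ?_) fun h => ?_)
    · rw [b1, ind_ne_zero] at h
      have ecard : (below F (m + 1)).card =
          (below F m).card + 1 := by
        rw [below_succ_of_mem hm h, Finset.card_insert_of_notMem (notMem_below F hm)]
      have hle : (below F (m + 1)).card ≤ W.k := by
        simpa using Finset.card_le_univ (below F (m + 1))
      refine wp_op ((2 ^ (W.k + 1)) ^ (below F (m + 1)).card) ?_ ?_
        (hstep _ (fun r hr => ?_) rfl (by simp))
      · rw [f1 _ (by norm_num), f1 _ (by norm_num), h3, h8, ecard, pow_succ]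
        rfl
      · rw [← pow_mul]
        exact lt_of_le_of_lt (Nat.pow_le_pow_right (by norm_num)
          (Nat.mul_le_mul_left _ (by omega))) hL.weight
      · rw [State.reg_setReg, if_neg (by omega)]
    · rw [b1, ind_eq_zero] at h
      refine wp_skip (hstep _ (fun _ _ => rfl) rfl ?_)
      rw [f1 _ (by norm_num), h3]
      rw [below_succ_of_notMem hm h]
  · rintro τ' hfr' ⟨h1, -, h3⟩
    refine ⟨fun r hr => ?_, h1, ?_⟩
    · rw [hfr' r (by omega), State.reg_setReg, State.reg_setReg, if_neg (by omega),
        if_neg (by omega)]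
    · rw [h3, below_top]

/-- The pointwise product of the arrays given by the registers `x` and `y` into that given by
`arr`. -/
def mulProg (x y arr : ℕ) : Prog :=
  fillProg arr 32 (.load 32 x 30 ;; .load 33 y 30 ;; .op .mul 32 32 33)

theorem wp_mulProg (hE : Env W σ) {x y arr ax ay a : ℕ} (f g : Finset (Fin W.k) → ℕ)
    (hx : x < 30) (hy : y < 30) (harr : arr < 30)
    (hax : σ.reg x = ax) (hay : σ.reg y = ay) (ha : σ.reg arr = a)
    (hf : ∀ F, σ.mem ax (mask F) = f F) (hg : ∀ F, σ.mem ay (mask F) = g F)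
    (hlt : ∀ F, f F * g F < 2 ^ L) :
    WP inp L (mulProg x y arr) σ (2 ^ W.k * 7 + 3) fun σ' =>
      (∀ r < 30, σ'.reg r = σ.reg r) ∧ (∀ a', a' ≠ a → σ'.mem a' = σ.mem a') ∧
        ∀ F, σ'.mem a (mask F) = f F * g F := by
  refine wp_fillProg (N := 3) hE _ ha harr fun τ F hfr hF hm hm' => ?_
  have hcell : ∀ a', τ.mem a' (mask F) = σ.mem a' (mask F) := by
    intro a'
    by_cases e : a' = a
    · rw [e, hm']
    · rw [hm a' e]
  have hy32 : y ≠ 32 := by omega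
  refine wp_seq (N' := 2) (wp_load (f F) (by rw [hfr x hx, hax, hF, hcell, hf])
    (wp_seq (N' := 1) (wp_load (g F) (by simp [hy32, hfr y hy, hay, hF, hcell, hg])
    (wp_op (f F * g F) (by simp [Op.eval]) (hlt F) ⟨fun r hr => ?_, rfl, by simp⟩))))
  have h1 : r ≠ 32 := by omega
  have h2 : r ≠ 33 := by omega
  simp [h1, h2]

/-- The subset convolution of the set families in the arrays given by the registers 13 and 14, into
the array given by register 15; register 16 holds 3, and the arrays 2 and 3 are used as work
space. -/
def convProg : Prog :=
  mulProg 13 1 5 ;; mulProg 14 1 16 ;; zetaProg 5 ;; zetaProg 16 ;; mulProg 5 16 16 ;;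
    moebiusProg 16 ;;
    fillProg 15 32 (.load 32 16 30 ;; .load 33 1 30 ;; .op .mul 33 33 8 ;; .op .div 34 32 33 ;;
      .op .mul 34 34 33 ;; .op .sub 32 32 34 ;; .ite 32 (.const 32 1) .skip)

theorem wp_convProg (hE : Env W σ) (hL : Large W B L) {af ag ao : ℕ}
    (f g : Finset (Fin W.k) → Prop) (h13 : σ.reg 13 = af) (h14 : σ.reg 14 = ag)
    (h15 : σ.reg 15 = ao) (h16 : σ.reg 16 = 3) (hag : 4 ≤ ag) (hao : 4 ≤ ao)
    (hf : ∀ F, σ.mem af (mask F) = ind (f F)) (hg : ∀ F, σ.mem ag (mask F) = ind (g F))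
    (hw : ∀ F : Finset (Fin W.k), σ.mem 1 (mask F) = (2 ^ (W.k + 1)) ^ F.card) :
    WP inp L convProg σ (2 ^ W.k * (W.k + 1) * 70) fun σ' =>
      (∀ r < 20, σ'.reg r = σ.reg r) ∧
      (∀ a, a ≠ 2 → a ≠ 3 → a ≠ ao → σ'.mem a = σ.mem a) ∧
        ∀ F, σ'.mem ao (mask F) = ind (∃ Y ⊆ F, f Y ∧ g (F \ Y)) := by
  have hs := hL.small
  have hwlt : ∀ (p : Finset (Fin W.k) → Prop) (F : Finset (Fin W.k)), weighted p F < 2 ^ L :=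
    fun p F => (weighted_le p F).trans_lt
      (lt_of_le_of_lt (Nat.le_mul_of_pos_left _ (by positivity)) hL.zeta_lt)
  have hzlt : ∀ F, partialZeta W.k (weighted f) F * partialZeta W.k (weighted g) F < 2 ^ L :=
    fun F => lt_of_le_of_lt (Nat.mul_le_mul (partialZeta_le (weighted_le f) F)
      (partialZeta_le (weighted_le g) F)) hL.square
  apply WP.mono (N := (2 ^ W.k * 7 + 3) + ((2 ^ W.k * 7 + 3) +
    ((W.k * (2 ^ W.k * 14 + 7) + 4) + ((W.k * (2 ^ W.k * 14 + 7) + 4) + ((2 ^ W.k * 7 + 3) +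
    ((W.k * (2 ^ W.k * 14 + 7) + 4) + (2 ^ W.k * 13 + 3)))))))
  swap
  · have h1 : 1 ≤ 2 ^ W.k := Nat.one_le_two_pow
    have h2 : W.k ≤ 2 ^ W.k * W.k := Nat.le_mul_of_pos_left _ h1
    nlinarith
  -- The constants in registers 1 and 5, namely 1 and 2, double as the numbers of the array of
  -- weights and of the first work array.
  refine wp_seq ((wp_mulProg hE (fun F => ind (f F)) (fun F => (2 ^ (W.k + 1)) ^ F.card)
    (by norm_num) (by norm_num) (by norm_num) h13 hE.one hE.two hf hw (hwlt f)).imp ?_)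
  rintro σ₁ ⟨f1, m1, v1⟩
  have hE1 := hE.congr fun r hr => f1 r (by omega)
  refine wp_seq ((wp_mulProg hE1 (fun F => ind (g F)) (fun F => (2 ^ (W.k + 1)) ^ F.card)
    (by norm_num) (by norm_num) (by norm_num) ((f1 14 (by norm_num)).trans h14) hE1.one
    ((f1 16 (by norm_num)).trans h16) (fun F => by rw [m1 ag (by omega), hg])
    (fun F => by rw [m1 1 (by omega), hw]) (hwlt g)).imp ?_)
  rintro σ₂ ⟨f2, m2, v2⟩
  have hE2 := hE1.congr fun r hr => f2 r (by omega)
  refine wp_seq ((wp_zetaProg hE2 hL (weighted f) (by norm_num) hE2.two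
    (fun F => by rw [m2 2 (by omega), v1]; rfl) (weighted_le f)).imp ?_)
  rintro σ₃ ⟨f3, m3, v3⟩
  have hE3 := hE2.congr fun r hr => f3 r (by omega)
  refine wp_seq ((wp_zetaProg hE3 hL (weighted g) (a := 3) (by norm_num)
    (by rw [f3 _ (by norm_num), f2 _ (by norm_num), f1 _ (by norm_num), h16])
    (fun F => by rw [m3 3 (by omega), v2]; rfl) (weighted_le g)).imp ?_)
  rintro σ₄ ⟨f4, m4, v4⟩
  have hE4 := hE3.congr fun r hr => f4 r (by omega)
  have h16' : σ₄.reg 16 = 3 := by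
    rw [f4 _ (by norm_num), f3 _ (by norm_num), f2 _ (by norm_num), f1 _ (by norm_num), h16]
  refine wp_seq ((wp_mulProg hE4 (partialZeta W.k (weighted f)) (partialZeta W.k (weighted g))
    (by norm_num) (by norm_num) (by norm_num) hE4.two h16' h16'
    (fun F => by rw [m4 2 (by omega), v3]) v4 hzlt).imp ?_)
  rintro σ₅ ⟨f5, m5, v5⟩
  have hE5 := hE4.congr fun r hr => f5 r (by omega)
  refine wp_seq ((wp_moebiusProg hE5 (unionProd (weighted f) (weighted g)) (by norm_num)
    ((f5 16 (by norm_num)).trans h16') (fun F => by rw [v5, partialZeta_unionProd])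
    (fun s F => (partialZeta_le_top s _ F).trans_lt
      (by rw [partialZeta_unionProd]; exact hzlt F))).imp ?_)
  rintro σ₆ ⟨f6, m6, v6⟩
  have hE6 := hE5.congr fun r hr => f6 r (by omega)
  have hfr : ∀ r < 20, σ₆.reg r = σ.reg r := by
    intro r hr
    rw [f6 _ hr, f5 _ (by omega), f4 _ hr, f3 _ hr, f2 _ (by omega), f1 _ (by omega)]
  have hmem : ∀ a, a ≠ 2 → a ≠ 3 → σ₆.mem a = σ.mem a := by
    intro a h2 h3
    rw [m6 a h3, m5 a h3, m4 a h3, m3 a h2, m2 a h3, m1 a h2]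
  refine (wp_fillProg hE6 (N := 9) (fun F => ind (∃ Y ⊆ F, f Y ∧ g (F \ Y))) (a := ao)
    (by rw [hfr _ (by norm_num), h15]) (by norm_num) ?_).imp ?_
  · intro τ F hτ h30 hm _
    have e16 : τ.reg 16 = 3 := by rw [hτ _ (by norm_num), hfr _ (by norm_num), h16]
    have e1 : τ.reg 1 = 1 := by rw [hτ _ (by norm_num), hE6.one]
    have e8 : τ.reg 8 = 2 ^ (W.k + 1) := by rw [hτ _ (by norm_num), hE6.base]
    set u := unionProd (weighted f) (weighted g) F with hu
    -- The modulus of `unionProd_weighted_mod`; the remainder is computed as `u - u / d * d`.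
    set d := (2 ^ (W.k + 1)) ^ F.card * 2 ^ (W.k + 1) with hd
    have hcard : F.card ≤ W.k := by simpa using Finset.card_le_univ F
    have huL : u < 2 ^ L := by
      have := partialZeta_le_top 0 (unionProd (weighted f) (weighted g)) F
      rw [partialZeta_zero, partialZeta_unionProd] at this
      exact this.trans_lt (hzlt F)
    have hdm := Nat.div_add_mod u d
    rw [mul_comm] at hdm
    refine wp_seq (N' := 8) (wp_load u (by rw [e16, h30, hm 3 (by omega), v6]) ?_)
    refine wp_seq (N' := 7) (wp_load ((2 ^ (W.k + 1)) ^ F.card) ?_ ?_)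
    · simp [e1, h30, hm 1 (by omega), hmem 1, hw]
    refine wp_seq (N' := 6) (wp_op d (by simp [Op.eval, e8, hd]) ?_ ?_)
    · rw [hd, ← pow_succ, ← pow_mul]
      exact lt_of_le_of_lt (Nat.pow_le_pow_right (by norm_num)
        (Nat.mul_le_mul_left _ (by omega))) hL.weight
    refine wp_seq (N' := 5) (wp_div (u / d) (by simp) ?_)
    refine wp_seq (N' := 4) (wp_op (u / d * d) (by simp [Op.eval]) (by omega) ?_)
    refine wp_seq (N' := 3) (wp_sub (u % d) (by simp; omega) ?_)
    have key := unionProd_weighted_mod f g F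
    have hfr6 : ∀ r ≤ 30, (((((((τ.setReg 32 u).setReg 33 ((2 ^ (W.k + 1)) ^ F.card)).setReg 33
        d).setReg 34 (u / d)).setReg 34 (u / d * d)).setReg 32 (u % d))).reg r = τ.reg r := by
      intro r hr
      have h1 : r ≠ 32 := by omega
      have h2 : r ≠ 33 := by omega
      have h3 : r ≠ 34 := by omega
      simp [h1, h2, h3]
    refine wp_ite (N := 1) (N' := 1) (fun h => ?_) fun h => ?_
    · refine wp_const (by omega) ⟨fun r hr => ?_, rfl, ?_⟩
      · rw [State.reg_setReg, if_neg (by omega), hfr6 r hr]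
      · rw [State.reg_setReg, if_pos rfl] at h
        rw [State.reg_setReg, if_pos rfl, ind_pos (key.1 h)]
    · refine wp_skip ⟨hfr6, rfl, ?_⟩
      rw [State.reg_setReg, if_pos rfl] at h ⊢
      rw [h, ind_neg]
      exact fun hc => key.2 hc h
  · rintro σ₇ ⟨f7, m7, v7⟩
    refine ⟨fun r hr => (f7 r (by omega)).trans (hfr r hr), fun a h2 h3 h4 => ?_, v7⟩
    rw [m7 a h4, hmem a h2 h3]

end

/-! ### Tables of the users and of the admissible sets -/

section

variable {W : Workflow} {B L : ℕ} {σ : State}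

/-- Register 23 becomes the set of the steps that the user in register 10 may perform. -/
def userMaskProg : Prog :=
  .const 22 1 ;; .const 23 0 ;;
    forLoop 20 2 (.op .mul 24 20 3 ;; .op .add 24 24 10 ;; .input 25 5 24 ;;
      .ite 25 (.op .add 23 23 22) .skip ;; .op .mul 22 22 5)

open Classical in
theorem wp_userMaskProg (hE : Env W σ) (hL : Large W B L) {u : ℕ} (h10 : σ.reg 10 = u)
    (hu : u < W.n) :
    WP W.input L userMaskProg σ (10 * W.k + 5) fun σ' =>
      (∀ r < 20, σ'.reg r = σ.reg r) ∧ σ'.mem = σ.mem ∧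
        σ'.reg 23 = mask (Finset.univ.filter fun s => W.AuthNat s u) := by
  have hs := hL.small
  set A := Finset.univ.filter fun s => W.AuthNat s u with hA
  refine (wp_seq (wp_const (by omega) (wp_seq (wp_const (by omega)
    (wp_forLoop (fun m σ' => σ'.mem = σ.mem ∧ σ'.reg 22 = 2 ^ m ∧
      σ'.reg 23 = mask (below A m)) W.k 7 (by simp [hE.steps])
      (by simp [hE.one]) (by norm_num) (by norm_num) ?_ ?_ ?_ ?_))))).mono (by omega)
  · rintro m τ v w ⟨h1, h2, h3⟩
    exact ⟨h1, by simpa using h2, by simpa using h3⟩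
  · exact ⟨rfl, by simp, by simp [below_zero]⟩
  · rintro m τ hm hi hfr ⟨h1, h2, h3⟩
    have hidx : m * W.n + u < 2 ^ L := by
      have : (m + 1) * W.n ≤ W.k * W.n := Nat.mul_le_mul_right _ hm
      have := hL.index
      rw [add_mul, one_mul] at *
      omega
    have e3 : τ.reg 3 = W.n := by simp [hfr 3, hE.users]
    have e5 : τ.reg 5 = 2 := by simp [hfr 5, hE.two]
    have e10 : τ.reg 10 = u := by simp [hfr 10, h10]
    have hin := Workflow.input_auth (W := W) ⟨m, hm⟩ hu
    simp only at hin
    refine wp_seq (N' := 6) (wp_op (m * W.n) (by rw [hi, e3]; rfl) (by omega) ?_)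
    refine wp_seq (N' := 5) (wp_op (m * W.n + u) (by simp [Op.eval, e10]) hidx ?_)
    refine wp_seq (N' := 4) (wp_input _ (by simp [e5, hin]; rfl)
      ((ind_le_one _).trans_lt (by omega)) ?_)
    refine wp_seq (N := 3) (N' := 1) (wp_ite (N := 1) (N' := 1) (fun h => ?_) fun h => ?_)
    · simp only [State.reg_setReg, if_true, ind_ne_zero] at h
      have hmem : (⟨m, hm⟩ : Fin W.k) ∈ A := by simpa [hA] using h
      refine wp_op (mask (below A (m + 1))) ?_
        ((mask_lt _).trans (hL.pow_lt (by omega))) ?_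
      · rw [below_succ_of_mem hm hmem, mask_insert (notMem_below A hm)]
        simp [Op.eval, h2, h3, add_comm]
      · refine wp_op (2 ^ (m + 1)) (by simp [Op.eval, h2, e5, pow_succ]) (hL.pow_lt (by omega))
          ⟨fun r hr => ?_, by simp [h1], by simp, by simp⟩
        have q1 : r ≠ 22 := by omega
        have q2 : r ≠ 23 := by omega
        have q3 : r ≠ 24 := by omega
        have q4 : r ≠ 25 := by omega
        simp [q1, q2, q3, q4]
    · simp only [State.reg_setReg, if_true, ind_eq_zero] at h
      have hmem : (⟨m, hm⟩ : Fin W.k) ∉ A := by simpa [hA] using h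
      refine wp_skip (wp_op (2 ^ (m + 1)) (by simp [Op.eval, h2, e5, pow_succ])
        (hL.pow_lt (by omega)) ⟨fun r hr => ?_, by simp [h1], by simp, ?_⟩)
      · have q1 : r ≠ 22 := by omega
        have q3 : r ≠ 24 := by omega
        have q4 : r ≠ 25 := by omega
        simp [q1, q3, q4]
      · rw [below_succ_of_notMem hm hmem]
        simp [h3]
  · rintro τ hfr ⟨h1, -, h3⟩
    refine ⟨fun r hr => ?_, h1, by rw [h3, below_top]⟩
    rw [hfr r hr, State.reg_setReg, State.reg_setReg, if_neg (by omega), if_neg (by omega)]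

/-- Process the user in register 10, say `u`: the array `2 * u + 4` gets the sets of steps that the
user may perform, and the array `2 * u + 7` those that can be divided among the users up to `u`. -/
def userProg : Prog :=
  userMaskProg ;; .op .add 12 23 0 ;; .op .mul 13 10 5 ;; .const 14 4 ;; .op .add 13 13 14 ;;
    .op .add 14 13 1 ;; .op .add 15 14 5 ;; .const 16 3 ;;
    fillProg 13 43 (subsetProg 30 12 ;; .load 44 0 30 ;; .op .mul 43 43 44) ;; convProg

/-- Array 0 holds the admissible sets, array 1 the weights, and arrays 2 and 3 are work space. From
4 on, even arrays hold `Fits` and odd ones `Coverable`. As `2 * u + 7 = 2 * (u + 1) + 5`, the output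
is in place for the next user, and earlier tables survive for the backtracking. -/
theorem wp_userProg (hE : Env W σ) (hL : Large W B L) {u : ℕ} (h10 : σ.reg 10 = u)
    (hu : u < W.n) (hadm : ∀ F, σ.mem 0 (mask F) = ind (W.Admissible F))
    (hw : ∀ F : Finset (Fin W.k), σ.mem 1 (mask F) = (2 ^ (W.k + 1)) ^ F.card)
    (hcov : ∀ F, σ.mem (2 * u + 5) (mask F) = ind (W.Coverable u F)) :
    WP W.input L userProg σ (2 ^ W.k * (W.k + 1) * 120) fun σ' =>
      (∀ r ≤ 10, σ'.reg r = σ.reg r) ∧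
      (∀ a, a ≠ 2 → a ≠ 3 → a ≠ 2 * u + 4 → a ≠ 2 * u + 7 → σ'.mem a = σ.mem a) ∧
      (∀ F, σ'.mem (2 * u + 4) (mask F) = ind (W.Fits u F)) ∧
      ∀ F, σ'.mem (2 * u + 7) (mask F) = ind (W.Coverable (u + 1) F) := by
  classical
  have hs := hL.small
  apply WP.mono (N := (10 * W.k + 5) + (1 + (1 + (1 + (1 + (1 + (1 + (1 +
    ((2 ^ W.k * ((17 * W.k + 7) + 4) + 3) + 2 ^ W.k * (W.k + 1) * 70)))))))))
  swap
  · have h1 : 1 ≤ 2 ^ W.k := Nat.one_le_two_pow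
    have h2 : W.k ≤ 2 ^ W.k * W.k := Nat.le_mul_of_pos_left _ h1
    nlinarith
  refine wp_seq ((wp_userMaskProg hE hL h10 hu).imp ?_)
  rintro σ₁ ⟨f1, m1, v1⟩
  set A := Finset.univ.filter fun s => W.AuthNat s u with hA
  have hE1 := hE.congr fun r hr => f1 r (by omega)
  have e10 : σ₁.reg 10 = u := by rw [f1 _ (by norm_num), h10]
  refine wp_seq (wp_op (mask A) (by simp [Op.eval, v1, hE1.zero])
    ((mask_lt A).trans (hL.pow_lt (by omega))) ?_)
  refine wp_seq (wp_op (2 * u) (by simp [Op.eval, e10, hE1.two, mul_comm]) (by omega) ?_)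
  refine wp_seq (wp_const (by omega) ?_)
  refine wp_seq (wp_op (2 * u + 4) (by simp [Op.eval]) (by omega) ?_)
  refine wp_seq (wp_op (2 * u + 5) (by simp [Op.eval, hE1.one]) (by omega) ?_)
  refine wp_seq (wp_op (2 * u + 7) (by simp [Op.eval, hE1.two]) (by omega) ?_)
  refine wp_seq (wp_const (by omega) ?_)
  set σ₂ := (((((((σ₁.setReg 12 (mask A)).setReg 13 (2 * u)).setReg 14 4).setReg 13
    (2 * u + 4)).setReg 14 (2 * u + 5)).setReg 15 (2 * u + 7)).setReg 16 3) with hσ₂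
  have f2 : ∀ r < 11, σ₂.reg r = σ₁.reg r := by
    intro r hr
    have q1 : r ≠ 12 := by omega
    have q2 : r ≠ 13 := by omega
    have q3 : r ≠ 14 := by omega
    have q4 : r ≠ 15 := by omega
    have q5 : r ≠ 16 := by omega
    simp [hσ₂, q1, q2, q3, q4, q5]
  have m2 : σ₂.mem = σ.mem := m1
  have e12 : σ₂.reg 12 = mask A := by simp [hσ₂]
  have e13 : σ₂.reg 13 = 2 * u + 4 := by simp [hσ₂]
  have e14 : σ₂.reg 14 = 2 * u + 5 := by simp [hσ₂]
  have e15 : σ₂.reg 15 = 2 * u + 7 := by simp [hσ₂]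
  have e16 : σ₂.reg 16 = 3 := by simp [hσ₂]
  clear_value σ₂
  have hE2 := hE1.congr fun r hr => f2 r (by omega)
  refine wp_seq ((wp_fillProg hE2 (N := 17 * W.k + 7) (fun F => ind (W.Fits u F)) e13 (by norm_num)
    ?_).imp ?_)
  · intro τ F hτ h30 hm _
    have hEτ := hE2.congr fun r hr => hτ r (by omega)
    refine (wp_seq (N' := 2) ((wp_subsetProg hEτ hL h30 ((hτ 12 (by norm_num)).trans e12)
      (by norm_num) (by norm_num)).imp ?_)).mono (by omega)
    rintro τ₁ ⟨f, m, v⟩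
    refine wp_seq (N' := 1) (wp_load (ind (W.Admissible F)) ?_ ?_)
    · rw [f 0 (by norm_num), hEτ.zero, f 30 (by norm_num), h30, m, hm 0 (by omega), m2, hadm]
    have hval : ind (F ⊆ A) * ind (W.Admissible F) = ind (W.Fits u F) := by
      rw [ind_mul]
      refine ind_congr ?_
      rw [Workflow.Fits, and_comm]
      refine and_congr_right fun _ => ?_
      simp [hA, Finset.subset_iff]
    refine wp_op (ind (W.Fits u F)) (by simp [Op.eval, v, hval])
      ((ind_le_one _).trans_lt (by omega)) ⟨fun r hr => ?_, m, by simp⟩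
    have q1 : r ≠ 43 := by omega
    have q2 : r ≠ 44 := by omega
    simp [q1, q2, f r (by omega)]
  rintro σ₃ ⟨f3, m3, v3⟩
  have hE3 := hE2.congr fun r hr => f3 r (by omega)
  refine (wp_convProg hE3 hL (W.Fits u) (W.Coverable u) ((f3 _ (by norm_num)).trans e13)
    ((f3 _ (by norm_num)).trans e14) ((f3 _ (by norm_num)).trans e15)
    ((f3 _ (by norm_num)).trans e16) (by omega) (by omega) v3
    (fun F => by rw [m3 _ (by omega), m2, hcov]) (fun F => by rw [m3 _ (by omega), m2, hw])).imp ?_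
  rintro σ₄ ⟨f4, m4, v4⟩
  refine ⟨fun r hr => ?_, fun a h2 h3 h4 h7 => ?_, fun F => ?_, v4⟩
  · rw [f4 _ (by omega), f3 _ (by omega), f2 _ (by omega), f1 _ (by omega)]
  · rw [m4 a h2 h3 h7, m3 a h4, m2]
  · rw [m4 _ (by omega) (by omega) (by omega), v3]

/-- Array 0 is filled with the admissible sets, by calls of the eligibility test `E`. -/
def admissibleProg (E : Prog) : Prog :=
  forLoop 10 6 (.const 22 1 ;;
    forLoop 20 4 (.op .mul 98 10 4 ;; .op .add 98 98 20 ;; .op .add 98 98 1 ;; .op .add 97 7 0 ;;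
      callProg 100 E 20 10 ;; .ite 100 .skip (.const 22 0)) ;;
    .ite 10 .skip (.const 22 1) ;; .store 0 10 22)

theorem wp_admissibleProg {E : Prog} (hdec : DecidesEligibility E W B) (hE : Env W σ)
    (hL : Large W B L) (hmem : ∀ a i, σ.mem a i = 0) (hreg : ∀ r, 100 ≤ r → σ.reg r = 0) :
    WP W.input L (admissibleProg E) σ (2 ^ W.k * (W.c * (E.regBound + 15 + 3 * B) + 12) + 3)
      fun σ' => (∀ r < 10, σ'.reg r = σ.reg r) ∧
        ∀ F, σ'.mem 0 (mask F) = ind (W.Admissible F) := by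
  apply WP.of_bdd
  intro hbd
  have hs := hL.small
  set M := 2 ^ W.k * W.c + 1 with hM
  have hML : M < 2 ^ L := hE.modulus.symm.trans_lt (hbd.reg 7)
  -- The call for `F` and `j` uses the residue `mask F * W.c + j + 1` modulo `M`. These residues
  -- increase with the calls, so all larger ones still belong to untouched memory. Residue 0 is
  -- never used by a call, which protects the table in array 0.
  refine (wp_forLoop (fun m σ' =>
    (∀ F : Finset (Fin W.k), mask F < m → σ'.mem 0 (mask F) = ind (W.Admissible F)) ∧
    (∀ a i, m * W.c < a % M → σ'.mem a i = 0) ∧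
    ∀ r, 100 + (E.regBound + 2) ≤ r → σ'.reg r = 0) (2 ^ W.k)
    (1 + ((W.c * (E.regBound + 12 + 3 * B + 3) + 3) + 5)) hE.sets hE.one (by norm_num) (by norm_num)
    ?_ ?_ ?_ ?_).mono (le_of_eq (by ring))
  · rintro m τ v w ⟨h1, h2, h3⟩
    refine ⟨h1, h2, fun r hr => ?_⟩
    rw [State.reg_setReg, State.reg_setReg, if_neg (by omega), if_neg (by omega), h3 r hr]
  · exact ⟨fun F h => absurd h (by omega), fun a i _ => hmem a i, fun r hr => hreg r (by omega)⟩
  · rintro m τ hm hi hfr ⟨h1, h2, h3⟩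
    obtain ⟨F, rfl⟩ := exists_mask_eq hm
    have hEτ := hE.congr fun r hr => hfr r hr
    refine wp_seq (wp_const (by omega) (wp_seq ?_))
    refine wp_forLoop (fun j τ' => τ'.mem 0 = τ.mem 0 ∧
      τ'.reg 22 = ind (∀ j' : Fin W.c, (j' : ℕ) < j → (W.con j').Eligible F) ∧
      (∀ a i, mask F * W.c + j < a % M → τ'.mem a i = 0) ∧
      ∀ r, 100 + (E.regBound + 2) ≤ r → τ'.reg r = 0) W.c (E.regBound + 12 + 3 * B)
      (by simp [hEτ.constraints]) (by simp [hEτ.one]) (by norm_num) (by norm_num) ?_ ?_ ?_ ?_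
    · rintro j τ' v w ⟨k1, k2, k3, k4⟩
      refine ⟨k1, by simpa using k2, k3, fun r hr => ?_⟩
      rw [State.reg_setReg, State.reg_setReg, if_neg (by omega), if_neg (by omega), k4 r hr]
    · refine ⟨rfl, ?_, fun a i h => h2 a i (by omega), fun r hr => ?_⟩
      · rw [ind_pos (by simp)]
        simp
      · rw [State.reg_setReg, if_neg (by omega), h3 r hr]
    · rintro j τ₁ hj hj' hfr₁ ⟨k1, k2, k3, k4⟩
      have hfr₁' : ∀ r < 20, τ₁.reg r = τ.reg r := fun r hr => by
        rw [hfr₁ r hr, State.reg_setReg, if_neg (by omega)]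
      have hE1 := hEτ.congr fun r hr => hfr₁' r (by omega)
      have e10 : τ₁.reg 10 = mask F := by rw [hfr₁' _ (by norm_num), hi]
      have hqM : mask F * W.c + j + 1 < M := by
        have : (mask F + 1) * W.c ≤ 2 ^ W.k * W.c := Nat.mul_le_mul_right _ hm
        rw [add_mul, one_mul] at this
        omega
      obtain ⟨t, σ', hrun, ht, hres⟩ := hdec ⟨j, hj⟩ F
      apply WP.mono (N := 1 + (1 + (1 + (1 + (E.regBound + 5 + 3 * B + 3)))))
      swap
      · omega
      refine wp_seq (wp_op (mask F * W.c) (by simp [Op.eval, e10, hE1.constraints]) (by omega) ?_)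
      refine wp_seq (wp_op (mask F * W.c + j) (by simp [Op.eval, hj']) (by omega) ?_)
      refine wp_seq (wp_op (mask F * W.c + j + 1) (by simp [Op.eval, hE1.one]) (by omega) ?_)
      refine wp_seq (wp_op M (by simp [Op.eval, hE1.modulus, hE1.zero, hM]) hML ?_)
      set τ₂ := (((τ₁.setReg 98 (mask F * W.c)).setReg 98 (mask F * W.c + j)).setReg 98
        (mask F * W.c + j + 1)).setReg 97 M with hτ₂
      have f2 : ∀ r, r ≠ 97 → r ≠ 98 → τ₂.reg r = τ₁.reg r := fun r q1 q2 => by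
        simp [hτ₂, q1, q2]
      have m2 : τ₂.mem = τ₁.mem := rfl
      refine wp_seq ((wp_callProg (q := mask F * W.c + j + 1) (M := M) (by norm_num) hqM hL.call.le hrun
        ht (by norm_num) (by norm_num) (by rw [f2 _ (by norm_num) (by norm_num), hj'])
        (by rw [f2 _ (by norm_num) (by norm_num), e10]) (by simp [hτ₂]) (by simp [hτ₂]) ?_ ?_).imp ?_)
      · intro r hr
        rw [f2 _ (by omega) (by omega), k4 r hr]
      · intro a i ha
        rw [m2, k3 a i (by omega)]
      rintro τ₃ ⟨v3, f3, g3, m3⟩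
      have hres' : τ₃.reg 100 = ind ((W.con ⟨j, hj⟩).Eligible F) := by
        rw [v3, hres, ind]
      have e22 : τ₃.reg 22 = ind (∀ j' : Fin W.c, (j' : ℕ) < j → (W.con j').Eligible F) := by
        rw [f3 _ (by norm_num), f2 _ (by norm_num) (by norm_num), k2]
      have hframe : ∀ r ≤ 20, τ₃.reg r = τ₁.reg r := fun r hr => by
        rw [f3 _ (by omega), f2 _ (by omega) (by omega)]
      have hmem0 : τ₃.mem 0 = τ.mem 0 := by
        rw [m3 0 (by simp), m2, k1]
      have hfresh : ∀ a i, mask F * W.c + (j + 1) < a % M → τ₃.mem a i = 0 := fun a i ha => by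
        rw [m3 a (by omega), m2, k3 a i (by omega)]
      have hhigh : ∀ r, 100 + (E.regBound + 2) ≤ r → τ₃.reg r = 0 := fun r hr => by
        rw [g3 r hr, f2 _ (by omega) (by omega), k4 r hr]
      refine wp_ite (N := 1) (N' := 1) (fun h => ?_) fun h => ?_
      · rw [hres', ind_ne_zero] at h
        refine wp_skip ⟨hframe, hmem0, e22.trans (ind_congr ?_), hfresh, hhigh⟩
        refine ⟨fun h' j' hlt => ?_, fun h' j' hlt => h' j' (by omega)⟩
        rcases Nat.lt_succ_iff_lt_or_eq.1 hlt with h'' | h''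
        · exact h' j' h''
        · obtain rfl : j' = ⟨j, hj⟩ := Fin.ext h''
          exact h
      · rw [hres', ind_eq_zero] at h
        refine wp_const (by omega) ⟨fun r hr => ?_, hmem0, ?_, hfresh, fun r hr => ?_⟩
        · rw [State.reg_setReg, if_neg (by omega), hframe r hr]
        · rw [State.reg_setReg, if_pos rfl, ind_neg]
          exact fun h' => h (h' ⟨j, hj⟩ (Nat.lt_succ_self j))
        · rw [State.reg_setReg, if_neg (by omega), hhigh r hr]
    · rintro τ₁ hfr₁ ⟨k1, k2, k3, k4⟩
      have hfr₁' : ∀ r < 20, τ₁.reg r = τ.reg r := fun r hr => by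
        rw [hfr₁ r hr, State.reg_setReg, if_neg (by omega)]
      have hstep : ∀ τ₂ : State, (∀ r, r ≠ 22 → τ₂.reg r = τ₁.reg r) → τ₂.mem = τ₁.mem →
          τ₂.reg 22 = ind (W.Admissible F) →
          WP W.input L (.store 0 10 22) τ₂ 1 fun σ' => (∀ r ≤ 10, σ'.reg r = τ.reg r) ∧
            (∀ G : Finset (Fin W.k), mask G < mask F + 1 →
              σ'.mem 0 (mask G) = ind (W.Admissible G)) ∧
            (∀ a i, (mask F + 1) * W.c < a % M → σ'.mem a i = 0) ∧
            ∀ r, 100 + (E.regBound + 2) ≤ r → σ'.reg r = 0 := by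
        intro τ₂ f2 m2 v2
        have hfr₂ : ∀ r ≤ 10, τ₂.reg r = τ.reg r := fun r hr => by
          rw [f2 _ (by omega), hfr₁' _ (by omega)]
        refine wp_store 0 (mask F) _ ((hfr₂ 0 (by norm_num)).trans hEτ.zero)
          ((hfr₂ 10 le_rfl).trans hi) v2 ⟨hfr₂, fun G hG => ?_, fun a i ha => ?_, fun r hr => ?_⟩
        · rw [State.mem_setMem]
          by_cases e : G = F
          · subst e; simp
          · have e' : mask G ≠ mask F := fun h => e (mask_injective h)
            rw [if_neg (by simp [e']), m2, k1, h1 G (by omega)]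
        · have ha0 : a ≠ 0 := by
            rintro rfl
            simp at ha
          rw [State.mem_setMem_of_ne _ ha0, m2]
          refine k3 a i ?_
          rw [add_mul, one_mul] at ha
          exact ha
        · rw [State.reg_setMem, f2 _ (by omega), k4 r hr]
      have k2' : τ₁.reg 22 = ind (∀ j, (W.con j).Eligible F) :=
        k2.trans (ind_congr ⟨fun h j => h j j.2, fun h j _ => h j⟩)
      have e10 : τ₁.reg 10 = mask F := by rw [hfr₁' _ (by norm_num), hi]
      -- The empty set is a class of no plan, so every constraint makes it ineligible. It is entered
      -- as admissible separately, because a user may have no step.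
      refine (wp_seq (N := 3) (N' := 1) (wp_ite (N := 1) (N' := 1) (fun h => ?_)
        fun h => ?_)).mono (by norm_num)
      · refine wp_skip (hstep _ (fun _ _ => rfl) rfl (k2'.trans (ind_congr ?_)))
        rw [e10, Ne, mask_eq_zero] at h
        simp [Workflow.Admissible, h]
      · refine wp_const (by omega) (hstep _ (fun r hr => ?_) rfl ?_)
        · rw [State.reg_setReg, if_neg hr]
        · rw [e10, mask_eq_zero] at h
          rw [State.reg_setReg, if_pos rfl, ind_pos (.inl h)]
  · rintro τ hfr ⟨h1, -, -⟩
    exact ⟨hfr, fun F => h1 F (mask_lt F)⟩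

end

/-! ### Reconstruction of a plan -/

section

variable {W : Workflow} {B L : ℕ} {σ : State}

/-- Register 32 becomes a set `Y` such that `Y` is in the family given by register 13, and the
difference of the set in register 12 and `Y` is in that given by register 14. -/
def chooseProg : Prog :=
  .const 32 0 ;; forLoop 30 6 (subsetProg 30 12 ;; .load 33 13 30 ;; .op .sub 34 12 30 ;;
    .load 34 14 34 ;; .op .mul 43 43 33 ;; .op .mul 43 43 34 ;; .ite 43 (.op .add 32 30 0) .skip)

theorem wp_chooseProg {inp : ℕ → ℕ → ℕ} (hE : Env W σ) (hL : Large W B L) {af ag : ℕ}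
    {C : Finset (Fin W.k)} (f g : Finset (Fin W.k) → Prop) (h12 : σ.reg 12 = mask C)
    (h13 : σ.reg 13 = af) (h14 : σ.reg 14 = ag)
    (hf : ∀ F, σ.mem af (mask F) = ind (f F)) (hg : ∀ F, σ.mem ag (mask F) = ind (g F))
    (hex : ∃ Y ⊆ C, f Y ∧ g (C \ Y)) :
    WP inp L chooseProg σ (2 ^ W.k * (17 * W.k + 16) + 4) fun σ' =>
      (∀ r < 30, σ'.reg r = σ.reg r) ∧ σ'.mem = σ.mem ∧
        ∃ Y ⊆ C, f Y ∧ g (C \ Y) ∧ σ'.reg 32 = mask Y := by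
  have hs := hL.small
  -- Register 32 holds the last suitable set met so far; before one is met, the implication is
  -- vacuous and the initial 0 stands for the empty set.
  refine (wp_seq (wp_const (by omega) (wp_forLoop (fun m σ' => σ'.mem = σ.mem ∧
    ∃ Y, σ'.reg 32 = mask Y ∧ ((∃ Y', mask Y' < m ∧ Y' ⊆ C ∧ f Y' ∧ g (C \ Y')) →
      Y ⊆ C ∧ f Y ∧ g (C \ Y))) (2 ^ W.k) (17 * W.k + 13) (by simp [hE.sets]) (by simp [hE.one])
    (by norm_num) (by norm_num) ?_ ?_ ?_ ?_))).mono (le_of_eq (by ring))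
  · rintro m τ v w ⟨h1, Y, h2, h3⟩
    exact ⟨h1, Y, by simpa using h2, h3⟩
  · exact ⟨rfl, ∅, by simp, fun ⟨Y', h, _⟩ => absurd h (by omega)⟩
  · rintro m τ hm hi hfr ⟨h1, Y, h2, h3⟩
    obtain ⟨F, rfl⟩ := exists_mask_eq hm
    have hfr' : ∀ r < 30, τ.reg r = σ.reg r := fun r hr => by
      rw [hfr r hr, State.reg_setReg, if_neg (by omega)]
    have hEτ := hE.congr fun r hr => hfr' r (by omega)
    refine (wp_seq (N' := 8) ((wp_subsetProg hEτ hL hi ((hfr' 12 (by norm_num)).trans h12)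
      (by norm_num) (by norm_num)).imp ?_)).mono (by omega)
    rintro τ₁ ⟨f1, m1, v1⟩
    have e12 : τ₁.reg 12 = mask C := by rw [f1 _ (by norm_num), hfr' _ (by norm_num), h12]
    have e13 : τ₁.reg 13 = af := by rw [f1 _ (by norm_num), hfr' _ (by norm_num), h13]
    have e14 : τ₁.reg 14 = ag := by rw [f1 _ (by norm_num), hfr' _ (by norm_num), h14]
    have e30 : τ₁.reg 30 = mask F := by rw [f1 _ (by norm_num), hi]
    have e0 : τ₁.reg 0 = 0 := by rw [f1 _ (by norm_num), hEτ.zero]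
    have e32 : τ₁.reg 32 = mask Y := by rw [f1 _ (by norm_num), h2]
    have m1' : τ₁.mem = σ.mem := m1.trans h1
    set x := σ.mem ag (mask C - mask F) with hx
    -- If `F` is not a subset of `C`, the truncated difference of the masks need not be the mask of
    -- `C \ F` and `x` may be arbitrary, but the other factor is 0.
    have hval : ind (F ⊆ C ∧ f F) * x = ind (F ⊆ C ∧ f F ∧ g (C \ F)) := by
      by_cases h : F ⊆ C
      · rw [hx, ← mask_sdiff h, hg, ind_mul]
        exact ind_congr (by tauto)
      · rw [ind_neg (by tauto), ind_neg (by tauto), zero_mul]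
    refine wp_seq (N' := 7) (wp_load (ind (f F)) (by rw [e13, e30, m1', hf]) ?_)
    refine wp_seq (N' := 6) (wp_sub (mask C - mask F) (by simp [e12, e30]) ?_)
    refine wp_seq (N' := 5) (wp_load x (by simp [e14, m1', hx]) ?_)
    refine wp_seq (N' := 4) (wp_op (ind (F ⊆ C ∧ f F)) (by simp [Op.eval, v1, ind_mul])
      ((ind_le_one _).trans_lt (by omega)) ?_)
    refine wp_seq (N' := 3) (wp_op (ind (F ⊆ C ∧ f F ∧ g (C \ F))) (by simp [Op.eval, hval])
      ((ind_le_one _).trans_lt (by omega)) ?_)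
    have hlow : ∀ (r : ℕ), r ≤ 30 → r ≠ 32 ∧ r ≠ 33 ∧ r ≠ 34 ∧ r ≠ 43 := fun r hr => by omega
    refine wp_ite (N := 1) (N' := 1) (fun h => ?_) fun h => ?_
    · simp only [State.reg_setReg, if_true, ind_ne_zero] at h
      refine wp_op (mask F) (by simp [Op.eval, e30, e0]) ((mask_lt F).trans (hL.pow_lt (by omega)))
        ⟨fun r hr => ?_, m1', F, by simp, fun _ => h⟩
      obtain ⟨q1, q2, q3, q4⟩ := hlow r hr
      simp [q1, q2, q3, q4, f1 r (by omega)]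
    · simp only [State.reg_setReg, if_true, ind_eq_zero] at h
      refine wp_skip ⟨fun r hr => ?_, m1', Y, by simp [e32], fun ⟨Y', hY', hgood⟩ => h3 ⟨Y', ?_, hgood⟩⟩
      · obtain ⟨-, q2, q3, q4⟩ := hlow r hr
        simp [q2, q3, q4, f1 r (by omega)]
      · have : mask Y' ≠ mask F := fun e => h (mask_injective e ▸ hgood)
        omega
  · rintro τ hfr ⟨h1, Y, h2, h3⟩
    obtain ⟨Y', hY'⟩ := hex
    obtain ⟨k1, k2, k3⟩ := h3 ⟨Y', mask_lt Y', hY'⟩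
    refine ⟨fun r hr => ?_, h1, Y, k1, k2, k3, h2⟩
    rw [hfr r hr, State.reg_setReg, if_neg (by omega)]

/-- Assign the user in register 15 to the steps in the set in register 17. -/
def assignProg : Prog :=
  .const 22 1 ;; forLoop 20 2 (bitProg 17 22 23 ;; .ite 23 (.store 0 20 15) .skip ;;
    .op .mul 22 22 5)

open Classical in
theorem wp_assignProg {inp : ℕ → ℕ → ℕ} (hE : Env W σ) (hL : Large W B L) {u : ℕ}
    {Y : Finset (Fin W.k)} (h15 : σ.reg 15 = u) (h17 : σ.reg 17 = mask Y) :
    WP inp L assignProg σ (W.k * 11 + 4) fun σ' =>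
      (∀ r < 20, σ'.reg r = σ.reg r) ∧ (∀ a, a ≠ 0 → σ'.mem a = σ.mem a) ∧
        ∀ s : Fin W.k, σ'.mem 0 s = if s ∈ Y then u else σ.mem 0 s := by
  have hs := hL.small
  refine (wp_seq (wp_const (by omega) (wp_forLoop (fun m σ' => σ'.reg 22 = 2 ^ m ∧
    (∀ a, a ≠ 0 → σ'.mem a = σ.mem a) ∧
    ∀ s : Fin W.k, σ'.mem 0 s = if s ∈ Y ∧ (s : ℕ) < m then u else σ.mem 0 s) W.k 8
    (by simp [hE.steps]) (by simp [hE.one]) (by norm_num) (by norm_num) ?_ ?_ ?_ ?_))).mono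
    (le_of_eq (by ring))
  · rintro m τ v w ⟨h1, h2⟩
    exact ⟨by simpa using h1, h2⟩
  · exact ⟨by simp, fun _ _ => rfl, fun s => by simp⟩
  · rintro m τ hm hi hfr ⟨h1, h2, h3⟩
    have hfr' : ∀ r < 20, τ.reg r = σ.reg r := fun r hr => by
      rw [hfr r hr, State.reg_setReg, if_neg (by omega)]
    have hEτ := hE.congr fun r hr => hfr' r (by omega)
    refine wp_seq (N := 4) (N' := 4) ((wp_bitProg (s := ⟨m, hm⟩) hEτ.two
      ((hfr' 17 (by norm_num)).trans h17) h1 (by norm_num)).imp ?_)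
    rintro τ₁ ⟨f1, m1, b1⟩
    have hstep : ∀ τ₂ : State, τ₂.reg = τ₁.reg → (∀ a, a ≠ 0 → τ₂.mem a = τ.mem a) →
        (∀ s : Fin W.k, τ₂.mem 0 s = if s ∈ Y ∧ (s : ℕ) < m + 1 then u else σ.mem 0 s) →
        WP inp L (.op .mul 22 22 5) τ₂ 1 fun σ' => (∀ r ≤ 20, σ'.reg r = τ.reg r) ∧
          σ'.reg 22 = 2 ^ (m + 1) ∧ (∀ a, a ≠ 0 → σ'.mem a = σ.mem a) ∧
          ∀ s : Fin W.k, σ'.mem 0 s = if s ∈ Y ∧ (s : ℕ) < m + 1 then u else σ.mem 0 s := by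
      intro τ₂ f2 m2 v2
      refine wp_op (2 ^ (m + 1)) ?_ (hL.pow_lt (by omega))
        ⟨fun r hr => ?_, by simp, fun a ha => (m2 a ha).trans (h2 a ha), v2⟩
      · rw [f2, f1 _ (by norm_num), f1 _ (by norm_num), h1, hEτ.two, pow_succ]
        rfl
      · rw [State.reg_setReg, if_neg (by omega), f2, f1 _ (by omega)]
    refine wp_seq (N := 3) (N' := 1) (wp_ite (N := 1) (N' := 1) (fun h => ?_) fun h => ?_)
    · rw [b1, ind_ne_zero] at h
      refine wp_store 0 m u ((f1 _ (by norm_num)).trans hEτ.zero) ((f1 _ (by norm_num)).trans hi)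
        (by rw [f1 _ (by norm_num), hfr' _ (by norm_num), h15]) (hstep _ rfl (fun a ha => ?_) fun s => ?_)
      · rw [State.mem_setMem_of_ne _ ha, m1]
      · rw [State.mem_setMem, m1, h3]
        by_cases e : (s : ℕ) = m
        · obtain rfl : s = ⟨m, hm⟩ := Fin.ext e
          simp [h]
        · rw [if_neg (by simp [e])]
          have : (s : ℕ) < m + 1 ↔ (s : ℕ) < m := by omega
          simp only [this]
    · rw [b1, ind_eq_zero] at h
      refine wp_skip (hstep _ rfl (fun a _ => by rw [m1]) fun s => ?_)
      rw [m1, h3]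
      by_cases e : (s : ℕ) = m
      · obtain rfl : s = ⟨m, hm⟩ := Fin.ext e
        simp [h]
      · have : (s : ℕ) < m + 1 ↔ (s : ℕ) < m := by omega
        simp only [this]
  · rintro τ hfr ⟨-, h2, h3⟩
    refine ⟨fun r hr => ?_, h2, fun s => by simp [h3]⟩
    rw [hfr r hr, State.reg_setReg, if_neg (by omega)]

/-- Construct a plan in array 0 from the tables, from the last user to the first. -/
def backtrackProg : Prog :=
  .op .sub 12 6 1 ;;
    forLoop 10 3 (.op .sub 15 3 10 ;; .op .sub 15 15 1 ;; .op .mul 13 15 5 ;; .const 16 4 ;;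
      .op .add 13 13 16 ;; .op .add 14 13 1 ;; chooseProg ;; .op .add 17 32 0 ;; assignProg ;;
      .op .sub 12 12 17)

theorem wp_backtrackProg {inp : ℕ → ℕ → ℕ} (hE : Env W σ) (hL : Large W B L)
    (regular : ∀ j, (W.con j).Regular)
    (hfits : ∀ u < W.n, ∀ F, σ.mem (2 * u + 4) (mask F) = ind (W.Fits u F))
    (hcov : ∀ u ≤ W.n, ∀ F, σ.mem (2 * u + 5) (mask F) = ind (W.Coverable u F))
    (hall : W.Coverable W.n Finset.univ) :
    WP inp L backtrackProg σ (W.n * (2 ^ W.k * (W.k + 1) * 50) + 4) fun σ' =>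
      ∃ π, W.Valid π ∧ ∀ s : Fin W.k, σ'.mem 0 s = (π s : ℕ) := by
  classical
  have hs := hL.small
  apply WP.mono (N := 1 + (W.n * (1 + (1 + (1 + (1 + (1 + (1 + ((2 ^ W.k * (17 * W.k + 16) + 4) +
    (1 + ((W.k * 11 + 4) + 1)))))))) + 3) + 3))
  swap
  · have h1 : 1 ≤ 2 ^ W.k := Nat.one_le_two_pow
    have h2 : W.k ≤ 2 ^ W.k * W.k := Nat.le_mul_of_pos_left _ h1
    have : 1 + (1 + (1 + (1 + (1 + (1 + ((2 ^ W.k * (17 * W.k + 16) + 4) +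
      (1 + ((W.k * 11 + 4) + 1)))))))) + 3 ≤ 2 ^ W.k * (W.k + 1) * 50 := by nlinarith
    have := Nat.mul_le_mul_left W.n this
    omega
  refine wp_seq (wp_sub (mask (Finset.univ : Finset (Fin W.k)))
    (by rw [mask_univ, hE.sets, hE.one]) ?_)
  -- `C` is the set of steps not yet assigned. The last `m` users share the others, and `C` can be
  -- divided among the remaining users. Only array 0 is overwritten, since the table of admissible
  -- sets is no longer needed.
  refine wp_forLoop (fun m σ' => ∃ C, σ'.reg 12 = mask C ∧ W.Coverable (W.n - m) C ∧
    (∀ a, a ≠ 0 → σ'.mem a = σ.mem a) ∧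
    (∀ s : Fin W.k, s ∉ C → W.n - m ≤ σ'.mem 0 s ∧ σ'.mem 0 s < W.n) ∧
    ∀ u, W.n - m ≤ u → u < W.n →
      W.Fits u (Finset.univ.filter fun s : Fin W.k => s ∉ C ∧ σ'.mem 0 s = u)) W.n _
    (by simp [hE.users]) (by simp [hE.one]) (by norm_num) (by norm_num) ?_ ?_ ?_ ?_
  · rintro m τ v w ⟨C, h1, h2⟩
    exact ⟨C, by simpa using h1, h2⟩
  · exact ⟨Finset.univ, by simp, hall, fun _ _ => rfl, fun s h => absurd (Finset.mem_univ s) h,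
      fun u h1 h2 => absurd h1 (by omega)⟩
  · rintro m τ hm hi hfr ⟨C, h1, h2, h3, h4, h5⟩
    have hfr' : ∀ r < 10, τ.reg r = σ.reg r := fun r hr => by
      rw [hfr r hr, State.reg_setReg, if_neg (by omega)]
    have hEτ := hE.congr hfr'
    obtain ⟨u, hu⟩ : ∃ u, W.n - m = u + 1 := ⟨W.n - m - 1, by omega⟩
    have hu' : W.n - (m + 1) = u := by omega
    rw [hu] at h2 h4 h5
    rw [hu']
    refine wp_seq (wp_sub (u + 1) (by rw [hEτ.users, hi, hu]) ?_)
    refine wp_seq (wp_sub u (by simp [hEτ.one]) ?_)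
    refine wp_seq (wp_op (2 * u) (by simp [Op.eval, hEτ.two, mul_comm]) (by omega) ?_)
    refine wp_seq (wp_const (by omega) ?_)
    refine wp_seq (wp_op (2 * u + 4) (by simp [Op.eval]) (by omega) ?_)
    refine wp_seq (wp_op (2 * u + 5) (by simp [Op.eval, hEτ.one]) (by omega) ?_)
    set τ₁ := (((((τ.setReg 15 (u + 1)).setReg 15 u).setReg 13 (2 * u)).setReg 16 4).setReg 13
      (2 * u + 4)).setReg 14 (2 * u + 5) with hτ₁
    have f1 : ∀ r < 13, τ₁.reg r = τ.reg r := by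
      intro r hr
      have q1 : r ≠ 13 := by omega
      have q2 : r ≠ 14 := by omega
      have q3 : r ≠ 15 := by omega
      have q4 : r ≠ 16 := by omega
      simp [hτ₁, q1, q2, q3, q4]
    have m1 : τ₁.mem = τ.mem := rfl
    have e13 : τ₁.reg 13 = 2 * u + 4 := by simp [hτ₁]
    have e14 : τ₁.reg 14 = 2 * u + 5 := by simp [hτ₁]
    have e15 : τ₁.reg 15 = u := by simp [hτ₁]
    clear_value τ₁
    have hE1 := hEτ.congr fun r hr => f1 r (by omega)
    refine wp_seq ((wp_chooseProg hE1 hL (W.Fits u) (W.Coverable u)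
      ((f1 12 (by norm_num)).trans h1) e13 e14
      (fun F => by rw [m1, h3 _ (by omega), hfits u (by omega)])
      (fun F => by rw [m1, h3 _ (by omega), hcov u (by omega)]) h2).imp ?_)
    rintro τ₂ ⟨f2, m2, Y, hYC, hYf, hYg, e32⟩
    have hE2 := hE1.congr fun r hr => f2 r (by omega)
    refine wp_seq (wp_op (mask Y) (by simp [Op.eval, e32, hE2.zero])
      ((mask_lt Y).trans (hL.pow_lt (by omega))) ?_)
    have f3 : ∀ r < 17, (τ₂.setReg 17 (mask Y)).reg r = τ₁.reg r := fun r hr => by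
      rw [State.reg_setReg, if_neg (by omega), f2 _ (by omega)]
    refine wp_seq ((wp_assignProg (hE1.congr fun r hr => f3 r (by omega)) hL (u := u) (Y := Y)
      (by rw [f3 _ (by norm_num), e15]) (by simp)).imp ?_)
    rintro τ₄ ⟨f4, m4, v4⟩
    have v4' : ∀ s : Fin W.k, τ₄.mem 0 s = if s ∈ Y then u else τ.mem 0 s := fun s => by
      rw [v4, State.mem_setReg, m2, m1]
    refine wp_sub (mask (C \ Y)) ?_ ⟨fun r hr => ?_, C \ Y, by simp, hYg, fun a ha => ?_,
      fun s hsC => ?_, fun w hw1 hw2 => ?_⟩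
    · rw [mask_sdiff hYC, f4 _ (by norm_num), f4 _ (by norm_num), f3 _ (by norm_num),
        f1 _ (by norm_num), h1]
      simp
    · rw [State.reg_setReg, if_neg (by omega), f4 _ (by omega), f3 _ (by omega), f1 _ (by omega)]
    · rw [State.mem_setReg, m4 a ha, State.mem_setReg, m2, m1, h3 a ha]
    · rw [State.mem_setReg, v4']
      split_ifs with hY
      · omega
      · have := h4 s fun hC => hsC (Finset.mem_sdiff.2 ⟨hC, hY⟩)
        omega
    · simp only [State.mem_setReg, v4', Finset.mem_sdiff, not_and, not_not]
      -- The current user gets exactly `Y`, because steps assigned earlier have larger user numbers.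
      -- The sets of later users are unchanged, because `Y` lies in `C`.
      rcases Nat.eq_or_lt_of_le hw1 with rfl | hlt
      · convert hYf using 1
        ext s
        simp only [Finset.mem_filter, Finset.mem_univ, true_and]
        by_cases hY : s ∈ Y
        · simp [hY]
        · simp only [hY, if_false, imp_false, iff_false, not_and]
          intro hC
          have := h4 s hC
          omega
      · convert h5 w hlt hw2 using 1
        ext s
        simp only [Finset.mem_filter, Finset.mem_univ, true_and]
        by_cases hY : s ∈ Y
        · simp [hY, hYC hY]
          omega
        · simp [hY]
  · rintro τ hfr ⟨C, h1, h2, h3, h4, h5⟩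
    -- What remains can be divided among no users, so it is empty and every step has its user.
    rw [Nat.sub_self] at h2 h4 h5
    obtain rfl : C = ∅ := h2
    refine ⟨fun s => ⟨τ.mem 0 s, (h4 s (Finset.notMem_empty s)).2⟩, Workflow.valid_of_fits regular fun s => ?_,
      fun s => rfl⟩
    convert h5 (τ.mem 0 s) (Nat.zero_le _) (h4 s (Finset.notMem_empty s)).2 using 1
    ext s'
    simp [Plan.block]

end

/-! ### The complete solver -/

section

variable {W : Workflow} {B L : ℕ} {σ : State}

/-- Read the parameters of the workflow and compute the constants. -/
def setupProg : Prog :=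
  .const 1 1 ;; .const 5 2 ;; .input 2 0 0 ;; .input 3 0 1 ;; .input 4 0 5 ;; .const 12 1 ;;
    forLoop 10 2 (.op .mul 12 12 5) ;; .op .add 6 12 0 ;; .op .mul 7 6 4 ;; .op .add 7 7 1 ;;
    .op .mul 8 6 5

theorem wp_setupProg (hL : Large W B L) :
    WP W.input L setupProg (start []) (4 * W.k + 13) fun σ' =>
      Env W σ' ∧ (∀ a i, σ'.mem a i = 0) ∧ ∀ r, 100 ≤ r → σ'.reg r = 0 := by
  have hs := hL.small
  have hM : 2 ^ W.k * W.c + 1 < 2 ^ L :=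
    lt_of_le_of_lt (Nat.le_mul_of_pos_left _ (by positivity)) hL.call
  have hc : W.c < 2 ^ L := by
    have : W.c ≤ 2 ^ W.k * W.c := Nat.le_mul_of_pos_left _ (by positivity)
    omega
  have hreg : ∀ r, (start []).reg r = 0 := fun r => by simp [start]
  apply WP.mono (N := 1 + (1 + (1 + (1 + (1 + (1 + ((W.k * (1 + 3) + 3) +
    (1 + (1 + (1 + 1))))))))))
  swap
  · omega
  refine wp_seq (wp_const (by omega) ?_)
  refine wp_seq (wp_const (by omega) ?_)
  refine wp_seq (wp_input W.k (by simp [hreg, Workflow.input])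
    (Nat.lt_two_pow_self.trans (hL.pow_lt (by omega))) ?_)
  refine wp_seq (wp_input W.n (by simp [hreg, Workflow.input]) (by omega) ?_)
  -- Register 5 holds 2, which serves here as the index of `c` in the input array 0.
  refine wp_seq (wp_input W.c (by simp [hreg, Workflow.input]) hc ?_)
  refine wp_seq (wp_const (by omega) (wp_seq ?_))
  refine wp_forLoop (fun m σ' => σ'.reg 12 = 2 ^ m ∧ (∀ a i, σ'.mem a i = 0) ∧
    ∀ r, 100 ≤ r → σ'.reg r = 0) W.k 1 (by simp) (by simp) (by norm_num) (by norm_num) ?_ ?_ ?_ ?_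
  · rintro m τ v w ⟨h1, h2, h3⟩
    refine ⟨by simpa using h1, h2, fun r hr => ?_⟩
    rw [State.reg_setReg, State.reg_setReg, if_neg (by omega), if_neg (by omega), h3 r hr]
  · refine ⟨by simp, fun _ _ => rfl, fun r hr => ?_⟩
    simp only [State.reg_setReg]
    repeat rw [if_neg (by omega)]
    exact hreg r
  · rintro m τ hm hi hfr ⟨h1, h2, h3⟩
    refine wp_op (2 ^ (m + 1)) (by simp [Op.eval, h1, hfr 5, pow_succ]) (hL.pow_lt (by omega))
      ⟨fun r hr => ?_, by simp, h2, fun r hr => ?_⟩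
    · rw [State.reg_setReg, if_neg (by omega)]
    · rw [State.reg_setReg, if_neg (by omega), h3 r hr]
  · rintro τ hfr ⟨h1, h2, h3⟩
    have e0 : τ.reg 0 = 0 := by simp [hfr, hreg]
    have e1 : τ.reg 1 = 1 := by simp [hfr]
    have e2 : τ.reg 2 = W.k := by simp [hfr]
    have e3 : τ.reg 3 = W.n := by simp [hfr]
    have e4 : τ.reg 4 = W.c := by simp [hfr]
    have e5 : τ.reg 5 = 2 := by simp [hfr]
    refine wp_seq (wp_op (2 ^ W.k) (by simp [Op.eval, h1, e0]) (hL.pow_lt (by omega)) ?_)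
    refine wp_seq (wp_op (2 ^ W.k * W.c) (by simp [Op.eval, e4]) (by omega) ?_)
    refine wp_seq (wp_op (2 ^ W.k * W.c + 1) (by simp [Op.eval, e1]) hM ?_)
    refine wp_op (2 ^ (W.k + 1)) (by simp [Op.eval, e5, pow_succ]) (hL.pow_lt le_rfl)
      ⟨?_, h2, fun r hr => ?_⟩
    · constructor <;> simp [*]
    · simp only [State.reg_setReg]
      repeat rw [if_neg (by omega)]
      exact h3 r hr

/-- The table of the sets that can be divided among no users. -/
def noUsersProg : Prog :=
  .const 12 5 ;; fillProg 12 32 (.ite 30 (.const 32 0) (.const 32 1))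

theorem wp_noUsersProg {inp : ℕ → ℕ → ℕ} (hE : Env W σ) (hL : Large W B L) :
    WP inp L noUsersProg σ (2 ^ W.k * 7 + 4) fun σ' =>
      (∀ r < 10, σ'.reg r = σ.reg r) ∧ (∀ a, a ≠ 5 → σ'.mem a = σ.mem a) ∧
        ∀ F, σ'.mem 5 (mask F) = ind (W.Coverable 0 F) := by
  have hs := hL.small
  have f1 : ∀ r < 10, (σ.setReg 12 5).reg r = σ.reg r := fun r hr => by
    rw [State.reg_setReg, if_neg (by omega)]
  refine (wp_seq (wp_const (by omega) ((wp_fillProg (N := 3) (hE.congr f1)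
    (fun F => ind (W.Coverable 0 F)) (a := 5) (by simp) (by norm_num) ?_).imp ?_))).mono (by omega)
  · intro τ F hτ h30 _ _
    refine wp_ite (N := 1) (N' := 1) (fun h => ?_) fun h => ?_
    · rw [h30, Ne, mask_eq_zero] at h
      refine wp_const (by positivity) ⟨fun r hr => ?_, rfl, ?_⟩
      · rw [State.reg_setReg, if_neg (by omega)]
      · rw [ind_neg (by exact h)]
        simp
    · rw [h30, mask_eq_zero] at h
      refine wp_const (by omega) ⟨fun r hr => ?_, rfl, ?_⟩
      · rw [State.reg_setReg, if_neg (by omega)]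
      · rw [ind_pos (by exact h)]
        simp
  · rintro τ ⟨h1, h2, h3⟩
    exact ⟨fun r hr => (h1 r (by omega)).trans (f1 r hr), h2, h3⟩

/-- The solver of the workflow satisfiability problem that uses the eligibility test `E`. -/
def solver (E : Prog) : Prog :=
  setupProg ;; admissibleProg E ;; weightProg ;; noUsersProg ;; forLoop 10 3 userProg ;;
    .op .mul 12 3 5 ;; .const 13 5 ;; .op .add 12 12 13 ;; .op .sub 13 6 1 ;; .load 12 12 13 ;;
    .ite 12 (backtrackProg ;; .const 0 1) .skip

theorem wp_solver {E : Prog} (hdec : DecidesEligibility E W B) (hL : Large W B L)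
    (regular : ∀ j, (W.con j).Regular) :
    WP W.input L (solver E) (start [])
      (2 ^ W.k * (W.k + 1) * (W.c * (E.regBound + 15 + 3 * B) + 180 * W.n + 100)) fun σ =>
      (σ.reg 0 = 1 ∧ ∃ π, W.Valid π ∧ ∀ s : Fin W.k, σ.mem 0 s = (π s : ℕ)) ∨
        (σ.reg 0 = 0 ∧ ¬ ∃ π, W.Valid π) := by
  have hs := hL.small
  apply WP.mono (N := (4 * W.k + 13) + ((2 ^ W.k * (W.c * (E.regBound + 15 + 3 * B) + 12) + 3) +
    ((2 ^ W.k * (W.k * 11 + 9) + 3) + ((2 ^ W.k * 7 + 4) +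
    ((W.n * (2 ^ W.k * (W.k + 1) * 120 + 3) + 3) + (1 + (1 + (1 + (1 + (1 +
    (1 + (W.n * (2 ^ W.k * (W.k + 1) * 50) + 4 + 1) + 1)))))))))))
  swap
  · have h1 : 1 ≤ 2 ^ W.k := Nat.one_le_two_pow
    have h2 : W.k ≤ 2 ^ W.k * W.k := Nat.le_mul_of_pos_left _ h1
    set P := 2 ^ W.k
    set Z := W.c * (E.regBound + 15 + 3 * B)
    have h3 : P ≤ P * (W.k + 1) := Nat.le_mul_of_pos_right _ (by omega)
    have h4 : P * Z ≤ P * (W.k + 1) * Z := Nat.mul_le_mul_right _ h3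
    have h5 : W.n * 1 ≤ W.n * (P * (W.k + 1)) := Nat.mul_le_mul_left _ (h1.trans h3)
    nlinarith
  refine wp_seq ((wp_setupProg hL).imp ?_)
  rintro σ₁ ⟨hE1, m1, z1⟩
  refine wp_seq ((wp_admissibleProg hdec hE1 hL m1 z1).imp ?_)
  rintro σ₂ ⟨f2, a2⟩
  have hE2 := hE1.congr f2
  refine wp_seq ((wp_weightProg hE2 hL).imp ?_)
  rintro σ₃ ⟨f3, m3, w3⟩
  have hE3 := hE2.congr fun r hr => f3 r (by omega)
  refine wp_seq ((wp_noUsersProg hE3 hL).imp ?_)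
  rintro σ₄ ⟨f4, m4, c4⟩
  have hE4 := hE3.congr f4
  refine wp_seq (wp_forLoop (fun m σ =>
    (∀ F, σ.mem 0 (mask F) = ind (W.Admissible F)) ∧
    (∀ F : Finset (Fin W.k), σ.mem 1 (mask F) = (2 ^ (W.k + 1)) ^ F.card) ∧
    (∀ u < m, ∀ F, σ.mem (2 * u + 4) (mask F) = ind (W.Fits u F)) ∧
    ∀ u ≤ m, ∀ F, σ.mem (2 * u + 5) (mask F) = ind (W.Coverable u F)) W.n _
    hE4.users hE4.one (by norm_num) (by norm_num) (fun _ _ _ _ h => h) ?_ ?_ ?_)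
  · refine ⟨fun F => ?_, fun F => ?_, fun u hu => absurd hu (by omega), fun u hu F => ?_⟩
    · rw [m4 0 (by norm_num), m3 0 (by norm_num), a2]
    · rw [m4 1 (by norm_num), w3]
    · obtain rfl : u = 0 := by omega
      exact c4 F
  · rintro u τ hu hi hfr ⟨h1, h2, h3, h4⟩
    refine (wp_userProg (hE4.congr hfr) hL hi hu h1 h2 (h4 u le_rfl)).imp ?_
    rintro τ' ⟨f, m, v4, v7⟩
    refine ⟨f, fun F => ?_, fun F => ?_, fun w hw F => ?_, fun w hw F => ?_⟩
    · rw [m 0 (by omega) (by omega) (by omega) (by omega), h1]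
    · rw [m 1 (by omega) (by omega) (by omega) (by omega), h2]
    · rcases Nat.lt_succ_iff_lt_or_eq.1 hw with hw | rfl
      · rw [m _ (by omega) (by omega) (by omega) (by omega), h3 w hw]
      · exact v4 F
    · rcases Nat.of_le_succ hw with hw | rfl
      · rw [m _ (by omega) (by omega) (by omega) (by omega), h4 w hw]
      · exact v7 F
  rintro σ₅ f5 ⟨-, -, hfits, hcov⟩
  have hE5 := hE4.congr f5
  refine wp_seq (wp_op (2 * W.n) (by simp [Op.eval, hE5.users, hE5.two, mul_comm]) (by omega) ?_)
  refine wp_seq (wp_const (by omega) ?_)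
  refine wp_seq (wp_op (2 * W.n + 5) (by simp [Op.eval]) (by omega) ?_)
  refine wp_seq (wp_sub (2 ^ W.k - 1) (by simp [hE5.sets, hE5.one]) ?_)
  refine wp_seq (wp_load (ind (W.Coverable W.n Finset.univ)) ?_ ?_)
  · simp [← mask_univ, hcov W.n le_rfl]
  set σ₆ := ((((σ₅.setReg 12 (2 * W.n)).setReg 13 5).setReg 12 (2 * W.n + 5)).setReg 13
    (2 ^ W.k - 1)).setReg 12 (ind (W.Coverable W.n Finset.univ)) with hσ₆
  have hE6 : Env W σ₆ := hE5.congr fun r hr => by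
    have q1 : r ≠ 12 := by omega
    have q2 : r ≠ 13 := by omega
    simp [hσ₆, q1, q2]
  have e12 : σ₆.reg 12 = ind (W.Coverable W.n Finset.univ) := by simp [hσ₆]
  refine wp_ite (fun h => ?_) fun h => ?_
  · rw [e12, ind_ne_zero] at h
    refine wp_seq ((wp_backtrackProg hE6 hL regular hfits hcov h).imp fun σ₇ h7 => ?_)
    exact wp_const (by omega) (.inl ⟨by simp, h7⟩)
  · rw [e12, ind_eq_zero] at h
    -- Register 0 has been kept at 0, which is already the negative answer.
    exact wp_skip (.inr ⟨hE6.zero, fun ⟨π, hπ⟩ => h hπ.coverable⟩)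

end

/-! ### Word length and total cost -/

theorem bdd_start (L : ℕ) : Bdd L (start []) :=
  ⟨fun r => by simp [start], fun a i => by simp [start]⟩

/-- The number of bits that describe the size of the workflow. -/
def Workflow.bits (W : Workflow) : ℕ := W.k + W.n.size + W.c.size + 1

/-- The quadratic term pays for the products of two zeta values, whose bound has exponent `2k + 2k(k
+ 1)`; the term `B` pays for the addresses of relocated calls, which have about `B + k + log c`
bits. -/
theorem large_bits (W : Workflow) (B : ℕ) : Large W B (B + 10 * W.bits ^ 2) := by
  have hn : W.n < 2 ^ W.n.size := Nat.lt_size_self _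
  have hc : W.c < 2 ^ W.c.size := Nat.lt_size_self _
  have hΛ : W.bits = W.k + W.n.size + W.c.size + 1 := rfl
  have hpow : ∀ {m : ℕ}, m ≤ B + 10 * W.bits ^ 2 → 2 ^ m ≤ 2 ^ (B + 10 * W.bits ^ 2) :=
    fun h => Nat.pow_le_pow_right (by norm_num) h
  have hpow' : ∀ {m : ℕ}, m < B + 10 * W.bits ^ 2 → 2 ^ m < 2 ^ (B + 10 * W.bits ^ 2) :=
    fun h => Nat.pow_lt_pow_right (by norm_num) h
  have hsq : W.bits ≤ W.bits ^ 2 := Nat.le_self_pow (by norm_num) _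
  refine ⟨?_, ?_, ?_, ?_, ?_⟩
  · refine le_trans ?_ (hpow (m := W.n.size + 4) (by omega))
    rw [pow_add]
    omega
  · refine le_trans ?_ (hpow (m := W.k + W.n.size) (by omega))
    rw [pow_add]
    exact Nat.mul_le_mul Nat.lt_two_pow_self.le hn.le
  · simp only [← pow_add]
    apply hpow'
    nlinarith
  · apply hpow'
    nlinarith
  · refine lt_of_le_of_lt ?_ (hpow' (m := B + (W.k + W.c.size)) (by omega))
    rw [pow_add, pow_add]
    refine Nat.mul_le_mul_left _ ?_
    have h1 : 1 ≤ 2 ^ W.k := Nat.one_le_two_pow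
    calc 2 ^ W.k * W.c + 1 ≤ 2 ^ W.k * (W.c + 1) := by rw [mul_add]; omega
      _ ≤ _ := Nat.mul_le_mul_left _ hc

/-- With T = `W.bound` positive, `c + n + 1 ≤ 2(c + n ^ 2)` gives the factor 2. For log T ≥ 1,
`bits` is at most `3 log T + 3 ≤ 6 log T`, whence the 6. The summand 1 on the right covers the cases
T = 0 and T = 1, where the logarithm is 0. -/
theorem bits_pow_le (W : Workflow) (e : ℕ) :
    2 ^ W.k * (W.c + W.n + 1) * W.bits ^ e ≤
      2 * 6 ^ e * (W.bound * Nat.log 2 W.bound ^ e + 1) := by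
  have hP : 1 ≤ 2 ^ W.k := Nat.one_le_two_pow
  have hΛ : W.bits = W.k + W.n.size + W.c.size + 1 := rfl
  have h6 : 1 ≤ 6 ^ e := Nat.one_le_pow _ _ (by norm_num)
  rcases Nat.eq_zero_or_pos (W.c + W.n ^ 2) with h0 | hpos
  · have hc : W.c = 0 := by omega
    have hn : W.n = 0 := by
      have : W.n ^ 2 = 0 := by omega
      simpa using this
    -- Without users there are no steps, as every step has an authorized user. This keeps `2 ^ W.k`
    -- bounded when T = 0.
    have hk : W.k = 0 := by
      by_contra hk
      obtain ⟨u, -⟩ := W.exists_auth ⟨0, Nat.pos_of_ne_zero hk⟩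
      exact absurd u.2 (by omega)
    rw [hΛ, hc, hn, hk]
    simp only [pow_zero, Nat.size_zero, zero_add, one_mul, one_pow]
    exact Nat.succ_le_of_lt (by positivity)
  set T := W.bound with hT
  have hTdef : T = 2 ^ W.k * (W.c + W.n ^ 2) := rfl
  have hle : W.c + W.n ^ 2 ≤ T := Nat.le_mul_of_pos_left _ hP
  have hT0 : T ≠ 0 := by omega
  have hnn : W.n ≤ W.n ^ 2 := Nat.le_self_pow (by norm_num) _
  have h2T : 2 ^ W.k * (W.c + W.n + 1) ≤ 2 * T := by
    rw [hTdef]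
    nlinarith
  have hlt : T < 2 ^ (Nat.log 2 T + 1) := Nat.lt_pow_succ_log_self (by norm_num) T
  have hk : W.k ≤ Nat.log 2 T :=
    Nat.le_log_of_pow_le (by norm_num) (Nat.le_mul_of_pos_right _ hpos)
  have hn : W.n.size ≤ Nat.log 2 T + 1 := Nat.size_le.2 (by omega)
  have hc : W.c.size ≤ Nat.log 2 T + 1 := Nat.size_le.2 (by omega)
  rcases Nat.eq_zero_or_pos (Nat.log 2 T) with hl | hl
  · have hT1 : T = 1 := by
      rw [hl] at hlt
      omega
    have : W.bits ^ e ≤ 6 ^ e := Nat.pow_le_pow_left (by omega) e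
    calc _ ≤ 2 * T * 6 ^ e := Nat.mul_le_mul h2T this
      _ ≤ _ := by rw [hT1]; nlinarith [Nat.zero_le (1 * Nat.log 2 1 ^ e)]
  · have : W.bits ^ e ≤ (6 * Nat.log 2 T) ^ e := Nat.pow_le_pow_left (by omega) e
    calc _ ≤ 2 * T * (6 * Nat.log 2 T) ^ e := Nat.mul_le_mul h2T this
      _ = 2 * 6 ^ e * (T * Nat.log 2 T ^ e) := by rw [mul_pow]; ring
      _ ≤ _ := Nat.mul_le_mul_left _ (Nat.le_succ _)

/-- The exponent `2 * d + 3` consists of 1 for the factor `k + 1`, of `d` for the operations of an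
eligibility test, and of `d + 2` for the word length. -/
theorem solver_cost_le (W : Workflow) (R a d : ℕ) :
    2 ^ W.k * (W.k + 1) * (W.c * (R + 15 + 3 * (a * W.bits ^ d)) + 180 * W.n + 100) *
      (3 * (a * W.bits ^ d + 10 * W.bits ^ 2) + 1) ≤
    (R + 3 * a + 200) * (3 * a + 31) * (2 ^ W.k * (W.c + W.n + 1) * W.bits ^ (2 * d + 3)) := by
  have hΛ : 1 ≤ W.bits := Nat.le_add_left _ _
  have hk : W.k + 1 ≤ W.bits := by
    rw [Workflow.bits]
    omega
  have hd : 1 ≤ W.bits ^ d := Nat.one_le_pow _ _ hΛ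
  have h2 : 1 ≤ W.bits ^ 2 := Nat.one_le_pow _ _ hΛ
  set x := W.bits ^ d
  set y := W.bits ^ 2
  have h3 : W.c * (R + 15 + 3 * (a * x)) + 180 * W.n + 100 ≤
      (R + 3 * a + 200) * ((W.c + W.n + 1) * x) := by
    have e1 : R + 15 + 3 * (a * x) ≤ (R + 3 * a + 200) * x := by nlinarith
    have e2 : 180 ≤ (R + 3 * a + 200) * x := by nlinarith
    calc _ ≤ W.c * ((R + 3 * a + 200) * x) + (R + 3 * a + 200) * x * W.n +
          (R + 3 * a + 200) * x := by gcongr; omega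
      _ = _ := by ring
  have h4 : 3 * (a * x + 10 * y) + 1 ≤ (3 * a + 31) * (x * y) := by
    have e1 : x ≤ x * y := Nat.le_mul_of_pos_right _ h2
    have e2 : y ≤ x * y := Nat.le_mul_of_pos_left _ hd
    nlinarith
  calc _ ≤ 2 ^ W.k * W.bits * ((R + 3 * a + 200) * ((W.c + W.n + 1) * x)) *
        ((3 * a + 31) * (x * y)) := by gcongr
    _ = (R + 3 * a + 200) * (3 * a + 31) *
        (2 ^ W.k * (W.c + W.n + 1) * (W.bits * (x * x) * y)) := by ring
    _ = _ := by
      congr 2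
      simp only [x, y]
      ring

end WSP

theorem theorem1 (𝒲 : Set WSP.Workflow)
    (regular : ∀ W ∈ 𝒲, ∀ j, (W.con j).Regular)
    (eligibility : ∃ (E : RAM.Prog) (a d : ℕ), ∀ W ∈ 𝒲,
      WSP.DecidesEligibility E W (a * (W.k + W.n.size + W.c.size + 1) ^ d)) :
    ∃ (P : RAM.Prog) (K d : ℕ), ∀ W ∈ 𝒲,
      WSP.Solves P W (K * (W.bound * Nat.log 2 W.bound ^ d + 1)) := by
  obtain ⟨E, a, d, hE⟩ := eligibility
  refine ⟨WSP.solver E, (E.regBound + 3 * a + 200) * (3 * a + 31) * (2 * 6 ^ (2 * d + 3)),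
    2 * d + 3, fun W hW => ?_⟩
  obtain ⟨t, σ, hrun, ht, -, hσ⟩ := WSP.wp_solver (hE W hW) (WSP.large_bits W _) (regular W hW)
    (WSP.bdd_start _)
  refine ⟨t, σ, hrun, ht.trans ((WSP.solver_cost_le W E.regBound a d).trans ?_), hσ⟩
  rw [mul_assoc _ (2 * 6 ^ (2 * d + 3))]
  exact Nat.mul_le_mul_left _ (WSP.bits_pow_le W _)
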